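/- Let $\mathfrak H$ be a finite-dimensional complex Hilbert space (inner product linear in the second argument) and let $\mathcal A(\mathfrak H)$ be the algebra of all linear operators on the antisymmetric Fock space over $\mathfrak H$, with creation operators $a^*(f)$ (linear in $f$) and annihilation operators $a(f)=(a^*(f))^*$, so that $\{a(f),a(g)\}=0$ and $\{a(f),a^*(g)\}=\langle f,g\rangle\mathbf 1$. A \emph{symbol} on $\mathfrak H$ is an operator $Q$ with $0\le Q\le\mathbf 1$. The gauge-invariant quasi-free state $\omega_Q$ with symbol $Q$ is the state on $\mathcal A(\mathfrak H)$ with $$\omega_Q\bigl(a^*(f_1)\cdots a^*(f_k)\,a(g_l)\cdots a(g_1)\bigr)=\begin{cases}\det\bigl(\langle g_i,Qf_j\rangle\bigr)_{i,j}&k=l,\\0&k\ne l.\end{cases}$$ Let $V,W$ be operators on $\mathfrak H$ with $0\le W\le\mathbf 1-V^*V$. A map $\Lambda$ on $\mathcal A(\mathfrak H)$ is called gauge-invariant quasi-free, determined by $(V,W)$, if on every normal-ordered monomial $a^\#(f_1)\cdots a^\#(f_N)$ (all creation operators to the left of all annihilation operators) $$\Lambda\bigl(a^\#(f_1)\cdots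 a^\#(f_N)\bigr)=\sum_{S\subset\{1,\dots,N\}}\epsilon(S)\Bigl(\prod_{j\in S}a^\#(Vf_j)\Bigr)\,\omega_W\Bigl(\prod_{k\notin S}a^\#(f_k)\Bigr),$$ where products are taken in increasing order of the index and $\epsilon(S)$ is the sign of the permutation that moves the indices in $S$ in front of those not in $S$ and keeps the order inside both groups. Let $\mathfrak X=(x_1,\dots,x_n)$ be an operational partition in $\mathcal A(\mathfrak H)$, i.e. $\sum_j x_j^*x_j=\mathbf 1$, such that the map $y\mapsto\sum_j x_j^*\,y\,x_j$ is gauge-invariant quasi-free, determined by $(V,W)$. Let $Q$ be a symbol on $\mathfrak H$, let $\rho[\mathfrak X]$ be the $n\times n$ correlation matrix with entries $\rho[\mathfrak X]_{ij}=\omega_Q(x_j^*x_i)$, and put $\mathsf H[\omega_Q,\mathfrak X]=\operatorname{Tr}\eta(\rho[\mathfrak X])$ with $\eta(x)=-x\log x$, $\eta(0)=0$. Let $\mathfrak K=Q(\mathbf 1-Q)\mathfrak H$ and define on $\mathfrak H\oplus\mathfrak K$ the operator $$R=\begin{pmatrix}V^*QV+W & V^*\sqrt{Q(\mathbf 1-Q)}\big|_{\mathfrak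 K}\\ \sqrt{Q(\mathbf 1-Q)}\,V & (\mathbf 1-Q)\big|_{\mathfrak K}\end{pmatrix}.$$ Then $0\le R\le\mathbf 1$, there is exactly one gauge-invariant quasi-free state $\omega_R$ on $\mathcal A(\mathfrak H\oplus\mathfrak K)$ with symbol $R$, and $$\mathsf H[\omega_Q,\mathfrak X]=S(\omega_R),$$ where $S(\omega_R)=\operatorname{Tr}\eta(\rho_R)$ is the von Neumann entropy of $\omega_R$, $\rho_R$ being the density matrix of $\omega_R$ on the antisymmetric Fock space over $\mathfrak H\oplus\mathfrak K$. -/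

import Mathlib

open scoped ComplexOrder

namespace FermionEntropy

noncomputable section

/-! ### The Fermion algebra on Fock space

For an orthonormal basis `b` of `H` indexed by a linearly ordered finite type `ι`, the antisymmetric
Fock space over `H` has the orthonormal basis `e_s = a*(b i₁) ⋯ a*(b i_k) Ω`, for the finite subsets
`s = {i₁ < ⋯ < i_k}` of `ι`.  The algebra `𝒜(H)` is the algebra of all `2^d × 2^d` matrices in this
basis. -/

/-- All operators on the antisymmetric Fock space, written in the occupation number basis. -/
abbrev FockMatrix (ι : Type*) : Type _ := Matrix (Finset ι) (Finset ι) ℂ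

/-- The matrix of `a*(b i)`: it maps `e_s` to `(-1)^{#{j ∈ s, j < i}} e_{s ∪ {i}}` if `i ∉ s`, and
to `0` if `i ∈ s`. -/
def modeCreation {ι : Type*} [LinearOrder ι] (i : ι) : FockMatrix ι :=
  Matrix.of fun t s =>
    if i ∉ s ∧ t = insert i s then (-1 : ℂ) ^ (s.filter (fun j => j < i)).card else 0

section CAR

variable {H : Type*} [NormedAddCommGroup H] [InnerProductSpace ℂ H]
variable {ι : Type*} [Fintype ι] [LinearOrder ι]

/-- The creation operator `a*(f)`, linear in `f`. -/
def creation (b : OrthonormalBasis ι ℂ H) (f : H) : FockMatrix ι :=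
  ∑ i, b.repr f i • modeCreation i

/-- The annihilation operator `a(f)`, the adjoint of `a*(f)`. -/
def annihilation (b : OrthonormalBasis ι ℂ H) (f : H) : FockMatrix ι :=
  (creation b f).conjTranspose

end CAR

/-! ### States and entropies -/

section Entropy

variable {m : Type*} [Fintype m] [DecidableEq m]

/-- A state on a full matrix algebra: a normalised positive linear functional. -/
structure IsState (ω : Matrix m m ℂ →ₗ[ℂ] ℂ) : Prop where
  map_one : ω 1 = 1
  nonneg : ∀ y : Matrix m m ℂ, 0 ≤ ω (y.conjTranspose * y)

/-- The density matrix of a functional, so that `ω y = Tr (ρ y)`. -/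
def densityMatrix (ω : Matrix m m ℂ →ₗ[ℂ] ℂ) : Matrix m m ℂ :=
  Matrix.of fun i j => ω (Matrix.single j i 1)

/-- `Tr η(ρ)` for `η(x) = -x log x`, `η(0) = 0`. -/
def vonNeumannEntropy (ρ : Matrix m m ℂ) : ℝ :=
  (cfc Real.negMulLog ρ).trace.re

/-- The von Neumann entropy `S(ω)` of a state. -/
def stateEntropy (ω : Matrix m m ℂ →ₗ[ℂ] ℂ) : ℝ :=
  vonNeumannEntropy (densityMatrix ω)

/-- An operational partition: `∑ j, x_j* x_j = 1`. -/
def IsOperationalPartition {n : ℕ} (x : Fin n → Matrix m m ℂ) : Prop :=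
  ∑ j, (x j).conjTranspose * x j = 1

/-- The correlation matrix with entries `ω(x_j* x_i)`. -/
def correlationMatrix {n : ℕ} (ω : Matrix m m ℂ →ₗ[ℂ] ℂ) (x : Fin n → Matrix m m ℂ) :
    Matrix (Fin n) (Fin n) ℂ :=
  Matrix.of fun i j => ω ((x j).conjTranspose * x i)

/-- The entropy `H[ω, X]` of a partition `X`. -/
def partitionEntropy {n : ℕ} (ω : Matrix m m ℂ →ₗ[ℂ] ℂ) (x : Fin n → Matrix m m ℂ) : ℝ :=
  vonNeumannEntropy (correlationMatrix ω x)

/-- The map `y ↦ ∑ j, x_j* y x_j` of a partition. -/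
def partitionMap {n : ℕ} (x : Fin n → Matrix m m ℂ) (y : Matrix m m ℂ) : Matrix m m ℂ :=
  ∑ j, (x j).conjTranspose * y * x j

end Entropy

/-! ### Gauge-invariant quasi-free states and maps -/

section QuasiFree

variable {H : Type*} [NormedAddCommGroup H] [InnerProductSpace ℂ H]

/-- A symbol: an operator with `0 ≤ Q ≤ 1` (in the sense of quadratic forms). -/
def IsSymbol (Q : H →L[ℂ] H) : Prop := 0 ≤ Q ∧ Q ≤ 1

variable {ι : Type*} [Fintype ι] [LinearOrder ι]

/-- The monomial `a*(f_1) ⋯ a*(f_k) a(g_l) ⋯ a(g_1)`. -/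
def normalMonomial (b : OrthonormalBasis ι ℂ H) {k l : ℕ} (f : Fin k → H) (g : Fin l → H) :
    FockMatrix ι :=
  (List.ofFn fun i => creation b (f i)).prod * (List.ofFn fun j => annihilation b (g j.rev)).prod

/-- `ω` is the gauge-invariant quasi-free state on `𝒜(H)` with symbol `Q`. -/
structure IsQuasiFreeState (b : OrthonormalBasis ι ℂ H) (Q : H →L[ℂ] H)
    (ω : FockMatrix ι →ₗ[ℂ] ℂ) : Prop where
  isSymbol : IsSymbol Q
  isState : IsState ω
  apply_eq_det : ∀ (k : ℕ) (f g : Fin k → H),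
    ω (normalMonomial b f g) = Matrix.det (Matrix.of fun i j => inner ℂ (g i) (Q (f j)))
  apply_eq_zero : ∀ (k l : ℕ) (f : Fin k → H) (g : Fin l → H), k ≠ l →
    ω (normalMonomial b f g) = 0

/-- The product of the `y i` with `i ∈ S`, in increasing order of `i`. -/
def orderedProd {A : Type*} [Monoid A] {N : ℕ} (S : Finset (Fin N)) (y : Fin N → A) : A :=
  (((List.finRange N).filter (fun i => i ∈ S)).map y).prod

/-- `ε(S)`: the sign of the permutation that moves the positions in `S` in front of those not in
`S`, and keeps the order inside both groups. -/
def shuffleSign {N : ℕ} (S : Finset (Fin N)) : ℂ :=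
  (-1) ^ (Finset.univ.filter
    (fun p : Fin N × Fin N => p.1 ∉ S ∧ p.2 ∈ S ∧ p.1 < p.2)).card

/-- The factors of a normal-ordered monomial of degree `N`: creation operators at the first `k`
positions, annihilation operators at the others. -/
def ladder (b : OrthonormalBasis ι ℂ H) (k : ℕ) {N : ℕ} (f : Fin N → H) (i : Fin N) :
    FockMatrix ι :=
  if (i : ℕ) < k then creation b (f i) else annihilation b (f i)

/-- `Λ` is the gauge-invariant quasi-free map determined by `(V, W)`, where `0 ≤ W ≤ 1 - V*V`: on
normal-ordered monomials (which span the algebra)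
`Λ(a^#(f_1) ⋯ a^#(f_N)) = ∑_S ε(S) ω_W(∏_{j ∉ S} a^#(f_j)) ∏_{j ∈ S} a^#(V f_j)`. -/
def IsQuasiFreeMap [CompleteSpace H] (b : OrthonormalBasis ι ℂ H) (V W : H →L[ℂ] H)
    (Λ : FockMatrix ι → FockMatrix ι) : Prop :=
  0 ≤ W ∧ W ≤ 1 - star V * V ∧
    ∃ ωW : FockMatrix ι →ₗ[ℂ] ℂ, IsQuasiFreeState b W ωW ∧
      ∀ (k N : ℕ) (f : Fin N → H),
        Λ (orderedProd Finset.univ (ladder b k f)) =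
          ∑ S : Finset (Fin N),
            (shuffleSign S * ωW (orderedProd Sᶜ (ladder b k f))) •
              orderedProd S (ladder b k fun i => V (f i))

end QuasiFree

/-! ### The block symbol -/

section Block

variable {H : Type*} [NormedAddCommGroup H] [InnerProductSpace ℂ H]

/-- The auxiliary space `K = Q(1 - Q)H`. -/
abbrev auxSpace (Q : H →L[ℂ] H) : Submodule ℂ H := LinearMap.range (Q * (1 - Q)).toLinearMap

/-- The operator `√(Q(1 - Q))`. -/
def sqrtVar [CompleteSpace H] (Q : H →L[ℂ] H) : H →L[ℂ] H := CFC.sqrt (Q * (1 - Q))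

theorem sqrtVar_mem [CompleteSpace H] [FiniteDimensional ℂ H] (Q : H →L[ℂ] H) (h : H) :
    sqrtVar Q h ∈ auxSpace Q := by
  by_cases hT : 0 ≤ Q * (1 - Q)
  · have hsq : sqrtVar Q * sqrtVar Q = Q * (1 - Q) := CFC.sqrt_mul_sqrt_self _ hT
    have hS : IsSelfAdjoint (sqrtVar Q) := IsSelfAdjoint.of_nonneg (CFC.sqrt_nonneg _)
    have hadj : ContinuousLinearMap.adjoint (sqrtVar Q) = sqrtVar Q := hS
    have hTadj : ContinuousLinearMap.adjoint (Q * (1 - Q)) = Q * (1 - Q) :=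
      IsSelfAdjoint.of_nonneg hT
    have key : (auxSpace Q)ᗮᗮ = auxSpace Q := Submodule.orthogonal_orthogonal _
    rw [← key, Submodule.mem_orthogonal]
    intro u hu
    have hu' : (Q * (1 - Q)) u = 0 := by
      refine ext_inner_left ℂ fun v => ?_
      rw [← hTadj, ContinuousLinearMap.adjoint_inner_right, inner_zero_right]
      exact (Submodule.mem_orthogonal _ _).1 hu _ ⟨v, rfl⟩
    have hSu : sqrtVar Q u = 0 := by
      rw [← inner_self_eq_zero (𝕜 := ℂ)]
      nth_rewrite 1 [← hadj]
      rw [ContinuousLinearMap.adjoint_inner_left,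
        show sqrtVar Q (sqrtVar Q u) = (sqrtVar Q * sqrtVar Q) u from rfl, hsq, hu',
        inner_zero_right]
    rw [← hadj, ContinuousLinearMap.adjoint_inner_right, hSu, inner_zero_left]
  · have : sqrtVar Q = 0 := CFC.sqrt_of_not_nonneg hT
    simp [this]

theorem one_sub_mem (Q : H →L[ℂ] H) {h : H} (hh : h ∈ auxSpace Q) : (1 - Q) h ∈ auxSpace Q := by
  obtain ⟨u, rfl⟩ := hh
  refine ⟨(1 - Q) u, ?_⟩
  simp [map_sub]

/-- The operator on `H ⊕ K` with blocks
`V*QV + W`, `V*√(Q(1-Q))|_K` (first row) and `√(Q(1-Q)) V`, `(1-Q)|_K` (second row). -/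
def blockSymbol [CompleteSpace H] [FiniteDimensional ℂ H] (Q V W : H →L[ℂ] H) :
    WithLp 2 (H × auxSpace Q) →L[ℂ] WithLp 2 (H × auxSpace Q) :=
  let e := WithLp.prodContinuousLinearEquiv 2 ℂ H (auxSpace Q)
  let top : H × auxSpace Q →L[ℂ] H :=
    (star V * Q * V + W).coprod ((star V * sqrtVar Q).comp (auxSpace Q).subtypeL)
  let bottom : H × auxSpace Q →L[ℂ] auxSpace Q :=
    ((sqrtVar Q * V).codRestrict (auxSpace Q) fun h => sqrtVar_mem Q (V h)).coprod
      (((1 - Q).comp (auxSpace Q).subtypeL).codRestrict (auxSpace Q)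
        fun h => one_sub_mem Q h.2)
  (e.symm : H × auxSpace Q →L[ℂ] WithLp 2 (H × auxSpace Q)).comp
    ((top.prod bottom).comp (e : WithLp 2 (H × auxSpace Q) →L[ℂ] H × auxSpace Q))

end Block

end

end FermionEntropy

/-! Let `s` be the square root of the density matrix of `ω_Q`. The correlation matrix is the
transposed Gram matrix of the Hilbert-Schmidt vectors `x_j s`. If `A` has these vectors as columns,
then `Aᴴ * A` and `A * Aᴴ` have the same nonzero spectrum, and since `η(0) = 0` they have the same
entropy (`partitionEntropy_traceForm`). The matrix `A * Aᴴ` is the image of the pure state of `s`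
when the partition map acts on left multiplications only (`traceForm_krausColumns`).

Left and right multiplication, twisted by the parity, represent the CAR over `H ⊕ H` on
Hilbert-Schmidt operators. In this picture `s` is a pure quasi-free state whose symbol is the
projection with blocks `Q`, `√(Q(1-Q))`, `√(Q(1-Q))`, `1-Q` (`pureDensity_mul_creation`). A
quasi-free map dilates: `a#(f)` becomes `a#(Vf)` plus an anticommuting copy of `a#(f)` that is
evaluated in `ω_W` (`dilation_word`, `dilation_double_word`). So the values of `A * Aᴴ` on monomials
are those of a product state on a triple tensor product. Wick's theorem (`wick_det`) turns them into
determinants of `doubleForm`, which is the form of `R` with `K` enlarged to `H`.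

On the complement of `K`, the kernel of `Q(1-Q)`, the off-diagonal blocks vanish and `1-Q` has only
the eigenvalues 0 and 1. These extra modes carry no entropy. Hence the entropy of `A * Aᴴ` is the
sum of `η(l) + η(1-l)` over the eigenvalues `l` of `R` (`partitionEntropy_eq_sum`), and the same sum
is the entropy of `ω_R`.

Wick's theorem rests on the exchange relation `D a*(f) = D a*(Qf) + a*(Qf) D` of a quasi-free
density `D`. It needs no inverse of `Q` or `1-Q`, so eigenvalues 0 and 1 require no separate
treatment. -/

namespace FermionEntropy

open Matrix
open scoped Kronecker

noncomputable section

/-! ### The standard modes -/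

section Modes

variable {ι : Type*} [LinearOrder ι]

/-- The Jordan-Wigner sign of the mode `i` in the configuration `s`. -/
def jwSign (i : ι) (s : Finset ι) : ℂ := (-1) ^ (s.filter (fun j => j < i)).card

theorem jwSign_mul_self (i : ι) (s : Finset ι) : jwSign i s * jwSign i s = 1 := by
  rw [jwSign, ← pow_add, ← two_mul, pow_mul]; simp

theorem star_jwSign (i : ι) (s : Finset ι) : star (jwSign i s) = jwSign i s := by
  simp [jwSign]

theorem jwSign_insert {i j : ι} {s : Finset ι} (hi : i ∉ s) :
    jwSign j (insert i s) = if i < j then -jwSign j s else jwSign j s := by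
  unfold jwSign
  rw [Finset.filter_insert]
  split_ifs
  · rw [Finset.card_insert_of_notMem (by simp [hi]), pow_succ]; ring
  · rfl

theorem jwSign_erase {i j : ι} {s : Finset ι} (hi : i ∈ s) :
    jwSign j (s.erase i) = if i < j then -jwSign j s else jwSign j s := by
  conv_rhs => rw [← Finset.insert_erase hi, jwSign_insert (Finset.notMem_erase i s)]
  split_ifs <;> simp

variable [Fintype ι]

/-- The free factor `X` lets products of several modes be evaluated by repeated rewriting. The sign
may be read off at `t` instead of `t.erase i`, because a mode does not count itself. -/
theorem modeCreation_mul_apply {n : Type*} (i : ι) (X : Matrix (Finset ι) n ℂ) (t : Finset ι)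
    (s : n) : (modeCreation i * X) t s = if i ∈ t then jwSign i t * X (t.erase i) s else 0 := by
  rw [Matrix.mul_apply]
  simp only [modeCreation, Matrix.of_apply]
  split_ifs with h
  · rw [Finset.sum_eq_single (t.erase i)]
    · rw [if_pos ⟨Finset.notMem_erase i t, (Finset.insert_erase h).symm⟩]
      change jwSign i (t.erase i) * _ = _
      rw [jwSign_erase h, if_neg (lt_irrefl i)]
    · rintro r - hr
      rw [if_neg, zero_mul]
      rintro ⟨h1, rfl⟩
      exact hr (Finset.erase_insert h1).symm
    · simp
  · refine Finset.sum_eq_zero fun r _ => ?_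
    rw [if_neg, zero_mul]
    rintro ⟨-, rfl⟩
    exact h (Finset.mem_insert_self i r)

theorem mul_modeCreation_apply {n : Type*} (i : ι) (X : Matrix n (Finset ι) ℂ) (t : n)
    (s : Finset ι) :
    (X * modeCreation i) t s = if i ∉ s then jwSign i s * X t (insert i s) else 0 := by
  rw [Matrix.mul_apply]
  simp only [modeCreation, Matrix.of_apply]
  by_cases h : i ∈ s
  · rw [if_neg (not_not.2 h)]
    exact Finset.sum_eq_zero fun r _ => by rw [if_neg (by tauto), mul_zero]
  · rw [if_pos h, Finset.sum_eq_single (insert i s)]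
    · rw [if_pos ⟨h, rfl⟩, mul_comm]; rfl
    · intro r _ hr
      rw [if_neg (by tauto), mul_zero]
    · simp

theorem conjTranspose_modeCreation_mul_apply {n : Type*} (i : ι) (X : Matrix (Finset ι) n ℂ)
    (t : Finset ι) (s : n) :
    ((modeCreation i)ᴴ * X) t s = if i ∉ t then jwSign i t * X (insert i t) s else 0 := by
  have := congrArg star (mul_modeCreation_apply i Xᴴ s t)
  rw [← Matrix.conjTranspose_apply, Matrix.conjTranspose_mul, Matrix.conjTranspose_conjTranspose]
    at this
  rw [this, apply_ite star, star_mul', star_jwSign, Matrix.conjTranspose_apply, star_star,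
    star_zero]

theorem mul_conjTranspose_modeCreation_apply {n : Type*} (i : ι) (X : Matrix n (Finset ι) ℂ)
    (t : n) (s : Finset ι) :
    (X * (modeCreation i)ᴴ) t s = if i ∈ s then jwSign i s * X t (s.erase i) else 0 := by
  have := congrArg star (modeCreation_mul_apply i Xᴴ s t)
  rw [← Matrix.conjTranspose_apply, Matrix.conjTranspose_mul, Matrix.conjTranspose_conjTranspose]
    at this
  rw [this, apply_ite star, star_mul', star_jwSign, Matrix.conjTranspose_apply, star_star,
    star_zero]

theorem modeCreation_anticomm (i j : ι) :
    modeCreation i * modeCreation j + modeCreation j * modeCreation i = 0 := by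
  wlog hij : i ≤ j generalizing i j
  · rw [add_comm]; exact this j i (le_of_not_ge hij)
  ext t s
  rw [Matrix.add_apply, ← Matrix.mul_one (modeCreation i * _),
    ← Matrix.mul_one (modeCreation j * _), Matrix.mul_assoc, Matrix.mul_assoc]
  simp only [modeCreation_mul_apply, Finset.mem_erase]
  rcases hij.eq_or_lt with rfl | hij
  · simp
  by_cases hi : i ∈ t <;> by_cases hj : j ∈ t <;>
    simp [hi, hj, hij.ne, hij.ne', jwSign_erase, hij, hij.not_gt]
  rw [Finset.erase_right_comm]; ring

theorem conjTranspose_modeCreation_anticomm (i j : ι) :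
    (modeCreation i)ᴴ * modeCreation j + modeCreation j * (modeCreation i)ᴴ
      = if i = j then 1 else 0 := by
  ext t s
  rw [Matrix.add_apply, ← Matrix.mul_one ((modeCreation i)ᴴ * _),
    ← Matrix.mul_one (modeCreation j * _), Matrix.mul_assoc, Matrix.mul_assoc]
  simp only [modeCreation_mul_apply, conjTranspose_modeCreation_mul_apply, Finset.mem_erase,
    Finset.mem_insert]
  by_cases hij : i = j
  · subst hij
    by_cases hi : i ∈ t
    · simp [hi, jwSign_erase, ← mul_assoc, jwSign_mul_self]
      rw [Finset.insert_erase hi]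
    · simp [hi, jwSign_insert, ← mul_assoc, jwSign_mul_self]
      rw [Finset.erase_insert hi]
  · by_cases hi : i ∈ t <;> by_cases hj : j ∈ t <;>
      simp [hi, hj, hij, Ne.symm hij, jwSign_erase, jwSign_insert]
    rw [Finset.erase_insert_of_ne hij]
    rcases lt_or_gt_of_ne hij with h | h <;> simp [h, h.not_gt] <;> ring

/-- Diagonal matrices are functions of the occupation numbers, and a creation operator shifts their
argument. The parity, the number operator and the product densities are all handled by this. -/
theorem diagonal_mul_modeCreation {d d' : Finset ι → ℂ} {i : ι}
    (h : ∀ s, i ∉ s → d (insert i s) = d' s) :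
    Matrix.diagonal d * modeCreation i = modeCreation i * Matrix.diagonal d' := by
  ext t s
  rw [mul_modeCreation_apply]
  simp only [Matrix.mul_diagonal, modeCreation, Matrix.of_apply, Matrix.diagonal_apply, jwSign]
  by_cases hi : i ∈ s
  · simp [hi]
  · by_cases ht : t = insert i s
    · simp [hi, ht, h s hi, mul_comm]
    · simp [hi, ht]

/-- A subspace of matrices that contains `1` and is stable under left multiplication by the modes
and their adjoints contains all matrices. -/
theorem eq_top_of_modeCreation_mul_mem (S : Submodule ℂ (FockMatrix ι)) (h1 : 1 ∈ S)
    (hc : ∀ i, ∀ y ∈ S, modeCreation i * y ∈ S) (ha : ∀ i, ∀ y ∈ S, (modeCreation i)ᴴ * y ∈ S) :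
    S = ⊤ := by
  -- `modeCreation i * (modeCreation i)ᴴ` is the projection onto configurations that contain `i`.
  have hn : ∀ (i : ι) (d : Finset ι → ℂ), Matrix.diagonal d ∈ S →
      Matrix.diagonal (fun t => if i ∈ t then d t else 0) ∈ S := by
    intro i d hd
    have := hc i _ (ha i _ hd)
    convert this using 1
    ext t s
    simp only [modeCreation_mul_apply, conjTranspose_modeCreation_mul_apply,
      Matrix.diagonal_apply]
    by_cases hi : i ∈ t
    · simp [hi, jwSign_erase, ← mul_assoc, jwSign_mul_self]
    · simp [hi]
  -- Products of these projections and their complements isolate a single configuration, one mode at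
  -- a time.
  have hd : ∀ (s l : Finset ι), Matrix.diagonal
      (fun t => if ∀ i ∈ l, (i ∈ t ↔ i ∈ s) then (1 : ℂ) else 0) ∈ S := by
    intro s l
    induction l using Finset.induction_on with
    | empty => simpa using h1
    | insert i l hi ih =>
      by_cases his : i ∈ s
      · convert hn i _ ih using 3 with t
        by_cases hit : i ∈ t <;> simp [his, hit]
      · convert S.sub_mem ih (hn i _ ih) using 1
        rw [Matrix.diagonal_sub]
        congr 1
        funext t
        by_cases hit : i ∈ t <;> simp [his, hit]
  have hss : ∀ s : Finset ι, Matrix.single s s (1 : ℂ) ∈ S := by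
    intro s
    convert hd s Finset.univ using 1
    ext t r
    simp only [Matrix.single_apply, Matrix.diagonal_apply, Finset.mem_univ, forall_true_left,
      ← Finset.ext_iff]
    by_cases h : t = s
    · subst h; simp
    · simp [h, Ne.symm h]
  have hca : ∀ (i : ι) (t s : Finset ι), i ∈ t → Matrix.single t s (1 : ℂ) ∈ S →
      Matrix.single (t.erase i) s (1 : ℂ) ∈ S := by
    intro i t s hi h
    convert S.smul_mem (jwSign i t) (ha i _ h) using 1
    ext r q
    simp only [Matrix.smul_apply, conjTranspose_modeCreation_mul_apply, Matrix.single_apply,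
      smul_eq_mul]
    by_cases hr : t.erase i = r
    · subst hr
      simp [Finset.insert_erase hi, jwSign_erase hi, jwSign_mul_self]
    · by_cases hir : i ∈ r
      · simp [hr, hir]
      · have : t ≠ insert i r := by
          rintro rfl; exact hr (Finset.erase_insert hir)
        simp [hr, this]
  have hcc : ∀ (i : ι) (t s : Finset ι), i ∉ t → Matrix.single t s (1 : ℂ) ∈ S →
      Matrix.single (insert i t) s (1 : ℂ) ∈ S := by
    intro i t s hi h
    convert S.smul_mem (jwSign i t) (hc i _ h) using 1
    ext r q
    simp only [Matrix.smul_apply, modeCreation_mul_apply, Matrix.single_apply, smul_eq_mul]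
    by_cases hr : insert i t = r
    · subst hr
      simp [Finset.erase_insert hi, jwSign_insert hi, jwSign_mul_self]
    · by_cases hir : i ∈ r
      · have : t ≠ r.erase i := by
          rintro rfl; exact hr (Finset.insert_erase hir)
        simp [hr, this]
      · simp [hr, hir]
  -- From the diagonal unit at `s`, the row index is emptied mode by mode and then refilled to any
  -- `t`.
  have hes : ∀ s t : Finset ι, Matrix.single (s \ t) s (1 : ℂ) ∈ S := by
    intro s t
    induction t using Finset.induction_on with
    | empty => simpa using hss s
    | insert i t hi ih =>
      rw [Finset.sdiff_insert]
      by_cases h : i ∈ s \ t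
      · exact hca i _ s h ih
      · rwa [Finset.erase_eq_of_notMem h]
  have hts : ∀ t s : Finset ι, Matrix.single t s (1 : ℂ) ∈ S := by
    intro t s
    induction t using Finset.induction_on with
    | empty => simpa using hes s s
    | insert i t hi ih => exact hcc i t s hi ih
  rw [eq_top_iff]
  intro y _
  rw [Matrix.matrix_eq_sum_single y]
  refine S.sum_mem fun t _ => S.sum_mem fun s _ => ?_
  have := S.smul_mem (y t s) (hts t s)
  rwa [Matrix.smul_single, smul_eq_mul, mul_one] at this

/-- A matrix that commutes with all modes and their adjoints is a scalar. -/
theorem eq_smul_one_of_commute_modeCreation (G : FockMatrix ι)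
    (hc : ∀ i, G * modeCreation i = modeCreation i * G)
    (ha : ∀ i, G * (modeCreation i)ᴴ = (modeCreation i)ᴴ * G) : G = G ∅ ∅ • 1 := by
  have h1 : ∀ (i : ι) (t s : Finset ι), i ∉ t → i ∈ s → G t s = 0 := by
    intro i t s ht hs
    have := congrFun (congrFun (hc i) t) (s.erase i)
    rw [mul_modeCreation_apply, modeCreation_mul_apply, if_pos (Finset.notMem_erase i s),
      if_neg ht, Finset.insert_erase hs] at this
    exact (mul_eq_zero.1 this).resolve_left (by simp [jwSign])
  have h2 : ∀ (i : ι) (t s : Finset ι), i ∈ t → i ∉ s → G t s = 0 := by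
    intro i t s ht hs
    have := congrFun (congrFun (ha i) (t.erase i)) s
    rw [mul_conjTranspose_modeCreation_apply, conjTranspose_modeCreation_mul_apply, if_neg hs,
      if_pos (Finset.notMem_erase i t), Finset.insert_erase ht] at this
    exact (mul_eq_zero.1 this.symm).resolve_left (by simp [jwSign])
  have h3 : ∀ s : Finset ι, G s s = G ∅ ∅ := by
    intro s
    induction s using Finset.induction_on with
    | empty => rfl
    | insert i s hi ih =>
      have := congrFun (congrFun (hc i) (insert i s)) s
      rw [mul_modeCreation_apply, modeCreation_mul_apply, if_pos hi,
        if_pos (Finset.mem_insert_self i s), Finset.erase_insert hi, jwSign_insert hi,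
        if_neg (lt_irrefl i), ih] at this
      exact mul_left_cancel₀ (by simp [jwSign]) this
  ext t s
  rw [Matrix.smul_apply, Matrix.one_apply]
  split_ifs with h
  · subst h; simp [h3]
  · obtain ⟨i, hi⟩ : ∃ i, ¬ (i ∈ t ↔ i ∈ s) := by
      by_contra hcon; push Not at hcon; exact h (Finset.ext hcon)
    by_cases ht : i ∈ t
    · simp [h2 i t s ht (by tauto)]
    · simp [h1 i t s ht (by tauto)]

end Modes

/-! ### Uniqueness of the representation of the canonical anticommutation relations -/

section CARRep

variable {κ m : Type*} [Fintype m] [DecidableEq m]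

/-- The canonical anticommutation relations for finitely many creation operators. -/
structure IsCAR [DecidableEq κ] (a : κ → Matrix m m ℂ) : Prop where
  anticomm : ∀ i j, a i * a j + a j * a i = 0
  anticomm_conjTranspose : ∀ i j, (a i)ᴴ * a j + a j * (a i)ᴴ = if i = j then 1 else 0

theorem IsCAR.mul_self [DecidableEq κ] {a : κ → Matrix m m ℂ} (ha : IsCAR a) (i : κ) :
    a i * a i = 0 := by
  have h := ha.anticomm i i
  rw [← two_smul ℂ] at h
  exact (smul_eq_zero.1 h).resolve_left two_ne_zero

theorem IsCAR.mul_comm_neg [DecidableEq κ] {a : κ → Matrix m m ℂ} (ha : IsCAR a) (i j : κ) :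
    a i * a j = -(a j * a i) :=
  eq_neg_of_add_eq_zero_left (ha.anticomm i j)

/-- A nonzero vector is treated mode by mode. If `(a i)ᴴ` does not kill it, its image is killed
because `(a i)ᴴ` squares to zero, and anticommutation keeps the image in the kernels reached before.
-/
theorem IsCAR.exists_vacuum [Fintype κ] [DecidableEq κ] [Nonempty m] {a : κ → Matrix m m ℂ}
    (ha : IsCAR a) : ∃ v : m → ℂ, star v ⬝ᵥ v = 1 ∧ ∀ i, (a i)ᴴ *ᵥ v = 0 := by
  have key : ∀ s : Finset κ, ∃ v : m → ℂ, v ≠ 0 ∧ ∀ i ∈ s, (a i)ᴴ *ᵥ v = 0 := by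
    intro s
    induction s using Finset.induction_on with
    | empty => exact ⟨1, one_ne_zero, by simp⟩
    | insert i s hi ih =>
      obtain ⟨v, hv, h⟩ := ih
      by_cases hiv : (a i)ᴴ *ᵥ v = 0
      · exact ⟨v, hv, by simpa [hiv] using h⟩
      · refine ⟨(a i)ᴴ *ᵥ v, hiv, ?_⟩
        intro j hj
        have h0 : (a j)ᴴ * (a i)ᴴ = -((a i)ᴴ * (a j)ᴴ) := by
          rw [← Matrix.conjTranspose_mul, ha.mul_comm_neg, Matrix.conjTranspose_neg,
            Matrix.conjTranspose_mul]
        rcases Finset.mem_insert.1 hj with rfl | hj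
        · rw [Matrix.mulVec_mulVec, ← Matrix.conjTranspose_mul, ha.mul_self]
          simp
        · rw [Matrix.mulVec_mulVec, h0, Matrix.neg_mulVec, ← Matrix.mulVec_mulVec, h j hj]
          simp
  obtain ⟨v, hv, h⟩ := key Finset.univ
  have hpos : 0 < star v ⬝ᵥ v := Matrix.dotProduct_star_self_pos_iff.2 hv
  obtain ⟨r, hr⟩ : ∃ r : ℝ, star v ⬝ᵥ v = r := ⟨_, (Complex.eq_re_of_ofReal_le hpos.le)⟩
  rw [hr] at hpos
  have hr0 : 0 < r := by exact_mod_cast hpos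
  refine ⟨((√r)⁻¹ : ℂ) • v, ?_, fun i => ?_⟩
  · rw [star_smul, smul_dotProduct, dotProduct_smul, hr]
    simp only [smul_eq_mul, Complex.star_def, map_inv₀, Complex.conj_ofReal]
    rw [← Complex.ofReal_inv, ← Complex.ofReal_mul, ← Complex.ofReal_mul, ← Complex.ofReal_one]
    congr 1
    have h2 : (√r) * √r = r := Real.mul_self_sqrt hr0.le
    have h3 : √r ≠ 0 := (Real.sqrt_pos.2 hr0).ne'
    field_simp
    nlinarith
  · rw [Matrix.mulVec_smul, h i (Finset.mem_univ i), smul_zero]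

/-- The product of the creation operators of a configuration, along a list of modes. -/
def configProd [DecidableEq κ] (a : κ → Matrix m m ℂ) (l : List κ) (s : Finset κ) :
    Matrix m m ℂ :=
  (l.map fun j => if j ∈ s then a j else 1).prod

theorem configProd_cons [DecidableEq κ] (a : κ → Matrix m m ℂ) (j : κ) (l : List κ)
    (s : Finset κ) :
    configProd a (j :: l) s = (if j ∈ s then a j else 1) * configProd a l s := by
  simp [configProd]

theorem configProd_insert_of_notMem [DecidableEq κ] (a : κ → Matrix m m ℂ) {i : κ} {l : List κ}
    (hi : i ∉ l) (s : Finset κ) : configProd a l (insert i s) = configProd a l s := by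
  unfold configProd
  congr 1
  refine List.map_congr_left fun j hj => ?_
  have : j ≠ i := by rintro rfl; exact hi hj
  simp [this]

/-- Moving `a i` to its place passes the smaller occupied modes, which gives the Jordan-Wigner sign;
meeting itself gives zero. For the induction the sign counts only modes in `l`. -/
theorem IsCAR.mul_configProd [LinearOrder κ] {a : κ → Matrix m m ℂ} (ha : IsCAR a) (i : κ)
    {l : List κ} (hl : l.SortedLT) (hi : i ∈ l) (s : Finset κ) :
    a i * configProd a l s =
      if i ∈ s then 0
      else ((-1 : ℂ) ^ (s.filter fun j => j ∈ l ∧ j < i).card) • configProd a l (insert i s) := by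
  induction l with
  | nil => simp at hi
  | cons j l ih =>
    have hp := List.pairwise_cons.1 hl.pairwise
    rw [configProd_cons]
    by_cases hij : i = j
    · subst hij
      have hil : i ∉ l := fun h => lt_irrefl _ (hp.1 i h)
      by_cases his : i ∈ s
      · simp [his, ← mul_assoc, ha.mul_self]
      · have : (s.filter fun j => j ∈ i :: l ∧ j < i) = ∅ := by
          refine Finset.filter_eq_empty_iff.2 fun j _ => ?_
          rintro ⟨h1, h2⟩
          rcases List.mem_cons.1 h1 with rfl | h1
          · exact lt_irrefl _ h2
          · exact lt_asymm h2 (hp.1 j h1)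
        rw [if_neg his, if_neg his, this, configProd_cons, configProd_insert_of_notMem a hil]
        simp
    · have hil : i ∈ l := (List.mem_cons.1 hi).resolve_left hij
      have hji : j < i := hp.1 i hil
      have hjl : j ∉ l := fun h => lt_irrefl _ (hp.1 j h)
      have ih' := ih hp.2.sortedLT hil
      by_cases hjs : j ∈ s
      · rw [if_pos hjs, ← mul_assoc, ha.mul_comm_neg, neg_mul, mul_assoc, ih']
        by_cases his : i ∈ s
        · simp [his]
        · have : (s.filter fun q => q ∈ j :: l ∧ q < i) =
              insert j (s.filter fun q => q ∈ l ∧ q < i) := by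
            ext q
            simp only [Finset.mem_filter, List.mem_cons, Finset.mem_insert]
            constructor
            · rintro ⟨h1, rfl | h2, h3⟩ <;> tauto
            · rintro (rfl | ⟨h1, h2, h3⟩) <;> tauto
          rw [if_neg his, if_neg his, this, Finset.card_insert_of_notMem (by simp [hjl]),
            configProd_cons, if_pos (Finset.mem_insert_of_mem hjs), pow_succ, mul_smul_comm]
          simp
      · rw [if_neg hjs, one_mul, ih']
        by_cases his : i ∈ s
        · simp [his]
        · have : (s.filter fun q => q ∈ j :: l ∧ q < i) = s.filter fun q => q ∈ l ∧ q < i := by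
            refine Finset.filter_congr fun q hq => ?_
            have : q ≠ j := by rintro rfl; exact hjs hq
            simp [this]
          have h2 : j ∉ insert i s := by simp [Ne.symm hij, hjs]
          rw [if_neg his, if_neg his, this, configProd_cons, if_neg h2, one_mul]

/-- The annihilator of an empty mode anticommutes with every factor present and so reaches the
vacuum. -/
theorem IsCAR.conjTranspose_mul_configProd_mulVec [DecidableEq κ] {a : κ → Matrix m m ℂ}
    (ha : IsCAR a) (i : κ) (l : List κ) {s : Finset κ} (hi : i ∉ s) {v : m → ℂ}
    (hv : (a i)ᴴ *ᵥ v = 0) : (a i)ᴴ *ᵥ (configProd a l s *ᵥ v) = 0 := by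
  induction l with
  | nil => simpa [configProd] using hv
  | cons j l ih =>
    rw [configProd_cons]
    by_cases hj : j ∈ s
    · have hij : i ≠ j := by rintro rfl; exact hi hj
      have h := ha.anticomm_conjTranspose i j
      rw [if_neg hij] at h
      rw [if_pos hj, Matrix.mulVec_mulVec, ← mul_assoc, eq_neg_of_add_eq_zero_left h, neg_mul,
        mul_assoc, Matrix.neg_mulVec, ← Matrix.mulVec_mulVec, ← Matrix.mulVec_mulVec, ih]
      simp
    · rwa [if_neg hj, one_mul]

/-- A representation of the canonical anticommutation relations of minimal dimension is unitarily
equivalent to the one on Fock space. -/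
theorem IsCAR.exists_unitary [Fintype κ] [LinearOrder κ] {a : κ → Matrix m m ℂ} (ha : IsCAR a)
    (hcard : Fintype.card m = 2 ^ Fintype.card κ) :
    ∃ u : Matrix m (Finset κ) ℂ, uᴴ * u = 1 ∧ u * uᴴ = 1 ∧
      ∀ i, u * modeCreation i * uᴴ = a i := by
  have : Nonempty m := Fintype.card_pos_iff.1 (by rw [hcard]; positivity)
  obtain ⟨v, hv1, hv⟩ := ha.exists_vacuum
  set l : List κ := (Finset.univ : Finset κ).sort (· ≤ ·) with hl
  have hls : l.SortedLT := Finset.sortedLT_sort _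
  have hlm : ∀ i, i ∈ l := fun i => by simp [hl]
  -- The columns are the configuration vectors built on the vacuum `v`, so `u` intertwines the two
  -- representations.
  let u : Matrix m (Finset κ) ℂ := Matrix.of fun t s => (configProd a l s *ᵥ v) t
  have hu : ∀ (x : Matrix m m ℂ) t s, (x * u) t s = (x *ᵥ (configProd a l s *ᵥ v)) t :=
    fun x t s => rfl
  have hmul : ∀ i s, i ∉ s → a i * configProd a l s = jwSign i s • configProd a l (insert i s) := by
    intro i s his
    rw [ha.mul_configProd i hls (hlm i), if_neg his]
    simp [hlm, jwSign]
  have h1 : ∀ i, a i * u = u * modeCreation i := by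
    intro i
    ext t s
    rw [mul_modeCreation_apply, hu, Matrix.mulVec_mulVec]
    by_cases his : i ∈ s
    · rw [ha.mul_configProd i hls (hlm i), if_pos his]
      simp [his]
    · rw [hmul i s his, if_pos his, Matrix.smul_mulVec]
      rfl
  have h2 : ∀ i, (a i)ᴴ * u = u * (modeCreation i)ᴴ := by
    intro i
    ext t s
    rw [mul_conjTranspose_modeCreation_apply, hu]
    by_cases his : i ∈ s
    · have h3 := hmul i (s.erase i) (Finset.notMem_erase i s)
      rw [Finset.insert_erase his, jwSign_erase his, if_neg (lt_irrefl i)] at h3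
      have h4 : configProd a l s = jwSign i s • (a i * configProd a l (s.erase i)) := by
        rw [h3, smul_smul, jwSign_mul_self, one_smul]
      have h5 := ha.anticomm_conjTranspose i i
      rw [if_pos rfl] at h5
      rw [h4, Matrix.smul_mulVec, Matrix.mulVec_smul, Matrix.mulVec_mulVec, ← mul_assoc,
        eq_sub_of_add_eq h5, sub_mul, Matrix.sub_mulVec, mul_assoc, ← Matrix.mulVec_mulVec,
        ← Matrix.mulVec_mulVec, ← Matrix.mulVec_mulVec, ha.conjTranspose_mul_configProd_mulVec i l
          (Finset.notMem_erase i s) (hv i), if_pos his]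
      simp [u]
    · rw [ha.conjTranspose_mul_configProd_mulVec i l his (hv i), if_neg his]
      rfl
  have h1' : ∀ i, uᴴ * (a i)ᴴ = (modeCreation i)ᴴ * uᴴ := fun i => by
    rw [← Matrix.conjTranspose_mul, h1, Matrix.conjTranspose_mul]
  have h2' : ∀ i, uᴴ * a i = modeCreation i * uᴴ := fun i => by
    have := congrArg Matrix.conjTranspose (h2 i)
    simpa [Matrix.conjTranspose_mul] using this
  -- By irreducibility of Fock space `uᴴ * u` is a scalar, and the norm of the vacuum shows that it
  -- is 1.
  have hG := eq_smul_one_of_commute_modeCreation (uᴴ * u)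
    (fun i => by rw [Matrix.mul_assoc, ← h1, ← Matrix.mul_assoc, h2', Matrix.mul_assoc])
    (fun i => by rw [Matrix.mul_assoc, ← h2, ← Matrix.mul_assoc, h1', Matrix.mul_assoc])
  have h0 : (uᴴ * u) ∅ ∅ = 1 := by
    rw [Matrix.mul_apply, ← hv1]
    refine Finset.sum_congr rfl fun t _ => ?_
    have : u t ∅ = v t := by simp [u, configProd]
    rw [Matrix.conjTranspose_apply, this]
    rfl
  rw [h0, one_smul] at hG
  -- Equality of dimensions makes the isometry unitary.
  have hG' : u * uᴴ = 1 := by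
    rwa [Matrix.mul_eq_one_comm_of_card_eq] at hG
    rw [hcard, Fintype.card_finset]
  exact ⟨u, hG, hG', fun i => by rw [← h1, Matrix.mul_assoc, hG', Matrix.mul_one]⟩

end CARRep

theorem roots_prod_X_sub_C_eq_map {m : Type*} [Fintype m] (d : m → ℂ) :
    (∏ i, (Polynomial.X - Polynomial.C (d i))).roots = Finset.univ.val.map d := by
  rw [← Polynomial.roots_multiset_prod_X_sub_C (Finset.univ.val.map d), Multiset.map_map]
  rfl

/-! ### The entropy in terms of the characteristic polynomial -/

section CharpolyEntropy

variable {m n : Type*} [Fintype m] [DecidableEq m] [Fintype n] [DecidableEq n]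

theorem vonNeumannEntropy_eq_sum_roots {M : Matrix m m ℂ} (hM : M.IsHermitian) :
    vonNeumannEntropy M = (M.charpoly.roots.map fun z : ℂ => Real.negMulLog z.re).sum := by
  have h1 : (cfc Real.negMulLog M).charpoly.roots =
      Finset.univ.val.map fun i => ((Real.negMulLog (hM.eigenvalues i) : ℝ) : ℂ) := by
    rw [hM.charpoly_cfc_eq, roots_prod_X_sub_C_eq_map]; rfl
  rw [vonNeumannEntropy, Matrix.trace_eq_sum_roots_charpoly, h1, hM.roots_charpoly_eq_eigenvalues]
  simp

/-- Powers of `X` only add zero roots, which are invisible since `η(0) = 0`. This compares matrices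
of different sizes. -/
theorem vonNeumannEntropy_congr {M : Matrix m m ℂ} {M' : Matrix n n ℂ} (hM : M.IsHermitian)
    (hM' : M'.IsHermitian)
    (h : ∃ i j : ℕ, Polynomial.X ^ i * M.charpoly = Polynomial.X ^ j * M'.charpoly) :
    vonNeumannEntropy M = vonNeumannEntropy M' := by
  obtain ⟨i, j, h⟩ := h
  have key : ∀ (k : ℕ) (p : Polynomial ℂ), p.Monic →
      ((Polynomial.X ^ k * p).roots.map fun z : ℂ => Real.negMulLog z.re).sum =
        (p.roots.map fun z : ℂ => Real.negMulLog z.re).sum := by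
    intro k p hp
    rw [Polynomial.roots_mul (mul_ne_zero (pow_ne_zero _ Polynomial.X_ne_zero) hp.ne_zero),
      Polynomial.roots_X_pow]
    simp [Multiset.map_nsmul, Multiset.sum_nsmul]
  rw [vonNeumannEntropy_eq_sum_roots hM, vonNeumannEntropy_eq_sum_roots hM',
    ← key i _ (Matrix.charpoly_monic M), h, key j _ (Matrix.charpoly_monic M')]

theorem vonNeumannEntropy_conjTranspose_mul_self (A : Matrix m n ℂ) :
    vonNeumannEntropy (Aᴴ * A) = vonNeumannEntropy (A * Aᴴ) :=
  vonNeumannEntropy_congr (Matrix.isHermitian_conjTranspose_mul_self A)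
    (Matrix.isHermitian_mul_conjTranspose_self A) ⟨_, _, Matrix.charpoly_mul_comm' _ _⟩

theorem vonNeumannEntropy_transpose {M : Matrix m m ℂ} (hM : M.IsHermitian) :
    vonNeumannEntropy Mᵀ = vonNeumannEntropy M :=
  vonNeumannEntropy_congr hM.transpose hM ⟨0, 0, by rw [Matrix.charpoly_transpose]⟩

theorem vonNeumannEntropy_diagonal (d : m → ℝ) :
    vonNeumannEntropy (Matrix.diagonal fun i => (d i : ℂ)) = ∑ i, Real.negMulLog (d i) := by
  rw [vonNeumannEntropy_eq_sum_roots (Matrix.isHermitian_diagonal_of_self_adjoint _ (by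
    ext i; simp)), Matrix.charpoly_diagonal, roots_prod_X_sub_C_eq_map]
  simp

theorem densityMatrix_trace_mul (ρ : Matrix m m ℂ) (ω : Matrix m m ℂ →ₗ[ℂ] ℂ)
    (h : ∀ y, ω y = (ρ * y).trace) : densityMatrix ω = ρ := by
  ext i j
  rw [densityMatrix, Matrix.of_apply, h, Matrix.trace_mul_comm]
  simp [Matrix.trace_single_mul]

end CharpolyEntropy

/-- The binary entropy of a product distribution is the sum of the binary entropies. -/
theorem sum_negMulLog_prod {κ : Type*} [DecidableEq κ] (l : κ → ℝ) (s : Finset κ) :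
    ∑ t ∈ s.powerset, ∏ i ∈ s, (if i ∈ t then l i else 1 - l i) = 1 ∧
      ∑ t ∈ s.powerset, Real.negMulLog (∏ i ∈ s, (if i ∈ t then l i else 1 - l i)) =
        ∑ i ∈ s, (Real.negMulLog (l i) + Real.negMulLog (1 - l i)) := by
  induction s using Finset.induction_on with
  | empty => simp
  | insert i s hi ih =>
    obtain ⟨ih1, ih2⟩ := ih
    have h1 : ∀ t ∈ s.powerset, ∏ j ∈ insert i s, (if j ∈ t then l j else 1 - l j) =
        (1 - l i) * ∏ j ∈ s, (if j ∈ t then l j else 1 - l j) := by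
      intro t ht
      rw [Finset.prod_insert hi, if_neg (fun h => hi (Finset.mem_powerset.1 ht h))]
    have h2 : ∀ t ∈ s.powerset, ∏ j ∈ insert i s, (if j ∈ insert i t then l j else 1 - l j) =
        l i * ∏ j ∈ s, (if j ∈ t then l j else 1 - l j) := by
      intro t ht
      rw [Finset.prod_insert hi, if_pos (Finset.mem_insert_self i t)]
      congr 1
      refine Finset.prod_congr rfl fun j hj => ?_
      have : j ≠ i := by rintro rfl; exact hi hj
      simp [this]
    rw [Finset.sum_powerset_insert hi, Finset.sum_powerset_insert hi, Finset.sum_insert hi]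
    constructor
    · rw [Finset.sum_congr rfl h1, Finset.sum_congr rfl h2, ← Finset.mul_sum, ← Finset.mul_sum,
        ih1]
      ring
    -- Uses `η(xy) = y η(x) + x η(y)` and the normalisation `ih1`.
    · rw [Finset.sum_congr rfl fun t ht =>
          (congrArg Real.negMulLog (h1 t ht)).trans (Real.negMulLog_mul _ _),
        Finset.sum_congr rfl fun t ht =>
          (congrArg Real.negMulLog (h2 t ht)).trans (Real.negMulLog_mul _ _),
        Finset.sum_add_distrib, Finset.sum_add_distrib, ← Finset.sum_mul, ← Finset.sum_mul,
        ← Finset.mul_sum, ← Finset.mul_sum, ih1, ih2]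
      ring

/-! ### Wick's theorem -/

section Wick

/-- The monomial `p(f_1) ⋯ p(f_k) q(g_l) ⋯ q(g_1)`. -/
def wickMonomial {A X Y : Type*} [Monoid A] (p : X → A) (q : Y → A) {k l : ℕ} (f : Fin k → X)
    (g : Fin l → Y) : A :=
  (List.ofFn fun i => p (f i)).prod * (List.ofFn fun j => q (g j.rev)).prod

variable {A X Y : Type*} [Ring A]

theorem prod_ofFn_rev_succ (q : Y → A) {l : ℕ} (g : Fin (l + 1) → Y) :
    (List.ofFn fun j => q (g j.rev)).prod =
      (List.ofFn fun j : Fin l => q (g j.rev.succ)).prod * q (g 0) := by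
  rw [List.ofFn_succ', List.prod_concat]
  simp [Fin.rev_castSucc]

variable [Algebra ℂ A]

/-- `P` moves left through the annihilators, and each exchange leaves a scalar. Since `g 0` stands
next to `P`, contracting with `g i` costs `i` sign changes. -/
theorem prod_annihilation_mul (q : Y → A) (P : A) (τ : Y → ℂ)
    (h : ∀ y, q y * P + P * q y = τ y • (1 : A)) {l : ℕ} (g : Fin (l + 1) → Y) :
    (List.ofFn fun j => q (g j.rev)).prod * P =
      (-1 : ℂ) ^ (l + 1) • (P * (List.ofFn fun j => q (g j.rev)).prod) +
        ∑ i : Fin (l + 1), ((-1 : ℂ) ^ (i : ℕ) * τ (g i)) •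
          (List.ofFn fun j : Fin l => q (g (i.succAbove j.rev))).prod := by
  have h' : ∀ y, q y * P = τ y • (1 : A) - P * q y := fun y => eq_sub_of_add_eq (h y)
  induction l with
  | zero => simp [h']; abel
  | succ l ih =>
    have ih' := ih fun j => g j.succ
    rw [prod_ofFn_rev_succ, mul_assoc, h', mul_sub, ← mul_assoc, ih']
    conv_rhs => rw [Fin.sum_univ_succ]
    have h2 : ∀ i : Fin (l + 1),
        (List.ofFn fun j : Fin (l + 1) => q (g (i.succ.succAbove j.rev))).prod =
          (List.ofFn fun j : Fin l => q (g (i.succAbove j.rev).succ)).prod * q (g 0) := by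
      intro i
      rw [prod_ofFn_rev_succ q fun j => g (i.succ.succAbove j)]
      simp
    simp only [h2, Fin.succAbove_zero, Fin.val_zero, Fin.val_succ, pow_zero, one_mul,
      mul_smul_comm, mul_one, add_mul, Finset.sum_mul, smul_mul_assoc, pow_succ _ (l + 1)]
    have h3 : ∀ i : Fin (l + 1), ((-1 : ℂ) ^ ((i : ℕ) + 1) * τ (g i.succ)) =
        -((-1 : ℂ) ^ (i : ℕ) * τ (g i.succ)) := fun i => by ring
    simp only [h3, neg_smul, Finset.sum_neg_distrib, mul_neg, mul_assoc, mul_one]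
    abel

theorem mul_prod_creation (p : X → A) (P : A) (h : ∀ x, P * p x = -(p x * P)) {k : ℕ}
    (f : Fin k → X) :
    P * (List.ofFn fun i => p (f i)).prod =
      (-1 : ℂ) ^ k • ((List.ofFn fun i => p (f i)).prod * P) := by
  induction k with
  | zero => simp
  | succ k ih =>
    rw [List.ofFn_succ, List.prod_cons, ← mul_assoc, h, neg_mul, mul_assoc, ih fun i => f i.succ,
      pow_succ, mul_smul_comm, mul_assoc]
    simp

/-- Wick's theorem: a functional with `ψ (p x * z) = ψ (p' x * z + z * p' x)` is given by
determinants on normal-ordered monomials. -/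
theorem wick_det (ψ : A →ₗ[ℂ] ℂ) (p p' : X → A) (q : Y → A) (τ : Y → X → ℂ)
    (hp : ∀ x x', p' x * p x' = -(p x' * p' x))
    (hq : ∀ y x, q y * p' x + p' x * q y = τ y x • (1 : A))
    (hψ : ∀ x z, ψ (p x * z) = ψ (p' x * z + z * p' x)) (h1 : ψ 1 = 1) (k : ℕ) (f : Fin k → X)
    (g : Fin k → Y) :
    ψ (wickMonomial p q f g) = Matrix.det (Matrix.of fun i j => τ (g i) (f j)) := by
  induction k with
  | zero => simp [wickMonomial, h1]
  | succ k ih =>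
    unfold wickMonomial
    -- The two terms that still contain `p' (f 0)` cancel: it passes `k` creators on one side and `k
    -- + 1` annihilators on the other. The contractions left over are the Laplace expansion along
    -- column zero.
    rw [List.ofFn_succ, List.prod_cons, mul_assoc, hψ, mul_assoc (List.prod _),
      prod_annihilation_mul q (p' (f 0)) (fun y => τ y (f 0)) (fun y => hq y _), ← mul_assoc,
      mul_prod_creation p _ (hp (f 0)), mul_add, pow_succ, smul_mul_assoc, mul_smul_comm, mul_assoc,
      ← add_assoc, mul_neg_one, neg_smul, add_neg_cancel, zero_add, Finset.mul_sum, map_sum,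
      Matrix.det_succ_column_zero]
    refine Finset.sum_congr rfl fun i _ => ?_
    rw [mul_smul_comm, map_smul, smul_eq_mul]
    congr 1
    exact ih (fun j => f j.succ) (fun j => g (i.succAbove j))

/-- A functional that is invariant under the derivation of a number operator vanishes on
monomials with different numbers of creation and annihilation operators. -/
theorem wick_zero (ψ : A →ₗ[ℂ] ℂ) (p : X → A) (q : Y → A) (N : A)
    (hp : ∀ x, N * p x = p x * N + p x) (hq : ∀ y, N * q y = q y * N - q y)
    (hψ : ∀ z, ψ (N * z) = ψ (z * N)) {k l : ℕ} (hkl : k ≠ l) (f : Fin k → X) (g : Fin l → Y) :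
    ψ (wickMonomial p q f g) = 0 := by
  have h1 : N * (List.ofFn fun i => p (f i)).prod =
      (List.ofFn fun i => p (f i)).prod * N + (k : ℂ) • (List.ofFn fun i => p (f i)).prod := by
    clear hkl
    induction k with
    | zero => simp
    | succ k ih =>
      rw [List.ofFn_succ, List.prod_cons, ← mul_assoc, hp, add_mul, mul_assoc, ih]
      push_cast
      simp only [mul_add, mul_smul_comm, add_smul, one_smul, mul_assoc]
      abel
  have h2 : ∀ (l : ℕ) (g : Fin l → Y), N * (List.ofFn fun j => q (g j)).prod =
      (List.ofFn fun j => q (g j)).prod * N - (l : ℂ) • (List.ofFn fun j => q (g j)).prod := by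
    intro l
    induction l with
    | zero => simp
    | succ k ih =>
      intro g
      rw [List.ofFn_succ, List.prod_cons, ← mul_assoc, hq, sub_mul, mul_assoc, ih]
      push_cast
      simp only [mul_sub, mul_smul_comm, add_smul, one_smul, mul_assoc]
      abel
  have h3 := hψ (wickMonomial p q f g)
  unfold wickMonomial at h3 ⊢
  rw [← mul_assoc, h1, add_mul, mul_assoc, h2 l fun j => g j.rev, mul_sub, mul_smul_comm,
    smul_mul_assoc, map_add, map_sub, map_smul, map_smul, mul_assoc] at h3
  -- The number operator raises the creators by `k` and lowers the annihilators by `l`.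
  have h4 : ((k : ℂ) - l) * ψ ((List.ofFn fun i => p (f i)).prod *
      (List.ofFn fun j => q (g j.rev)).prod) = 0 := by
    simp only [smul_eq_mul] at h3
    linear_combination h3
  refine (mul_eq_zero.1 h4).resolve_left ?_
  refine sub_ne_zero.2 ?_
  exact_mod_cast hkl

end Wick

/-! ### Product states of modes -/

section ModeStates

variable {κ m : Type*} [Fintype m] [DecidableEq m]

/-- The functional `y ↦ Tr (ρ y)`. -/
def traceForm (ρ : Matrix m m ℂ) : Matrix m m ℂ →ₗ[ℂ] ℂ :=
  (Matrix.traceLinearMap m ℂ ℂ).comp (LinearMap.mulLeft ℂ ρ)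

theorem traceForm_apply (ρ y : Matrix m m ℂ) : traceForm ρ y = (ρ * y).trace := rfl

theorem densityMatrix_traceForm (ρ : Matrix m m ℂ) : densityMatrix (traceForm ρ) = ρ :=
  densityMatrix_trace_mul ρ _ fun _ => rfl

theorem isState_traceForm {s : Matrix m m ℂ} (hs : sᴴ = s) (ht : (s * s).trace = 1) :
    IsState (traceForm (s * s)) where
  map_one := by rw [traceForm_apply, mul_one, ht]
  nonneg y := by
    have : traceForm (s * s) (yᴴ * y) = ((y * s)ᴴ * (y * s)).trace := by
      rw [traceForm_apply, Matrix.trace_mul_comm, ← mul_assoc, Matrix.trace_mul_comm,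
        Matrix.conjTranspose_mul, hs]
      simp only [mul_assoc]
    rw [this]
    exact (Matrix.posSemidef_conjTranspose_mul_self (y * s)).trace_nonneg

theorem prod_map_eq_wickMonomial {A X Y : Type*} [Monoid A] (p : X → A) (q : Y → A) (cs : List X)
    (ds : List Y) :
    (cs.map p).prod * (ds.map q).prod =
      wickMonomial p q (fun i : Fin cs.length => cs.get i)
        (fun j : Fin ds.length => ds.get j.rev) := by
  unfold wickMonomial
  simp only [Fin.rev_rev]
  congr 2
  · conv_lhs => rw [← List.ofFn_get cs, List.map_ofFn]
    rfl
  · conv_lhs => rw [← List.ofFn_get ds, List.map_ofFn]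
    rfl

/-- Normal-ordered monomials span everything: their span absorbs a creator on the left directly, and
an annihilator after it has been moved past the creators. -/
theorem modeCreation_ext [Fintype κ] [LinearOrder κ] {φ φ' : FockMatrix κ →ₗ[ℂ] ℂ}
    (h : ∀ (k l : ℕ) (f : Fin k → κ) (g : Fin l → κ),
      φ (wickMonomial modeCreation (fun i => (modeCreation i)ᴴ) f g) =
        φ' (wickMonomial modeCreation (fun i => (modeCreation i)ᴴ) f g)) : φ = φ' := by
  let mono : List κ × List κ → FockMatrix κ := fun c =>
    (c.1.map modeCreation).prod * (c.2.map fun i => (modeCreation i)ᴴ).prod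
  let S : Submodule ℂ (FockMatrix κ) := Submodule.span ℂ (Set.range mono)
  have hc : ∀ i, ∀ y ∈ S, modeCreation i * y ∈ S := by
    intro i y hy
    induction hy using Submodule.span_induction with
    | mem y hy =>
      obtain ⟨c, rfl⟩ := hy
      refine Submodule.subset_span ⟨(i :: c.1, c.2), ?_⟩
      simp [mono, mul_assoc]
    | zero => simp
    | add y z _ _ hy hz => rw [mul_add]; exact S.add_mem hy hz
    | smul r y _ hy => rw [mul_smul_comm]; exact S.smul_mem r hy
  have ha : ∀ i, ∀ y ∈ S, (modeCreation i)ᴴ * y ∈ S := by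
    intro i y hy
    induction hy using Submodule.span_induction with
    | mem y hy =>
      obtain ⟨⟨cs, ds⟩, rfl⟩ := hy
      simp only [mono]
      induction cs with
      | nil =>
        refine Submodule.subset_span ⟨([], i :: ds), ?_⟩
        simp [mono]
      | cons j cs ih =>
        rw [List.map_cons, List.prod_cons, mul_assoc, ← mul_assoc,
          eq_sub_of_add_eq (conjTranspose_modeCreation_anticomm i j), sub_mul, mul_assoc]
        refine S.sub_mem ?_ (hc j _ ih)
        split_ifs
        · rw [one_mul]
          exact Submodule.subset_span ⟨(cs, ds), rfl⟩
        · rw [zero_mul]; exact S.zero_mem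
    | zero => simp
    | add y z _ _ hy hz => rw [mul_add]; exact S.add_mem hy hz
    | smul r y _ hy => rw [mul_smul_comm]; exact S.smul_mem r hy
  have htop : S = ⊤ := eq_top_of_modeCreation_mul_mem S
    (Submodule.subset_span ⟨([], []), by simp [mono]⟩) hc ha
  refine LinearMap.ext_on htop ?_
  rintro _ ⟨c, rfl⟩
  simp only [mono, prod_map_eq_wickMonomial]
  exact h _ _ _ _

/-- `s` is the square root of the density matrix of the product state with occupation
probabilities `l`, `G` is the parity and `N` the number operator. -/
structure IsGaussianRoot (a : κ → Matrix m m ℂ) (l : κ → ℝ) (s G N : Matrix m m ℂ) : Prop where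
  conjTranspose_eq : sᴴ = s
  trace_mul_self : (s * s).trace = 1
  parity_conjTranspose : Gᴴ = G
  parity_mul_self : G * G = 1
  parity_anticomm : ∀ i, G * a i = -(a i * G)
  parity_comm : G * s = s * G
  number_conjTranspose : Nᴴ = N
  number_comm : N * s = s * N
  number_parity : N * G = G * N
  number_mul : ∀ i, N * a i = a i * N + a i
  -- The relation `s a = √(l/(1-l)) a s` cleared of denominators, so that `l = 0` and `l = 1` are
  -- allowed.
  mul_creation : ∀ i, (√(1 - l i) : ℂ) • (s * a i) = (√(l i) : ℂ) • (a i * s)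

/-- The root is diagonal, with a factor `√(l i)` for each occupied mode and `√(1 - l i)` for each
empty one. Its square is a product distribution over configurations, whose entropy is additive. -/
theorem exists_isGaussianRoot_modeCreation [Fintype κ] [LinearOrder κ] {l : κ → ℝ}
    (h0 : ∀ i, 0 ≤ l i) (h1 : ∀ i, l i ≤ 1) :
    ∃ s G N : FockMatrix κ, IsGaussianRoot modeCreation l s G N ∧
      vonNeumannEntropy (s * s) =
        ∑ i, (Real.negMulLog (l i) + Real.negMulLog (1 - l i)) := by
  let w : Finset κ → ℝ := fun t => ∏ i, if i ∈ t then √(l i) else √(1 - l i)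
  have hww : ∀ t, w t * w t = ∏ i, if i ∈ t then l i else 1 - l i := by
    intro t
    rw [← Finset.prod_mul_distrib]
    refine Finset.prod_congr rfl fun i _ => ?_
    split_ifs
    · exact Real.mul_self_sqrt (h0 i)
    · exact Real.mul_self_sqrt (sub_nonneg.2 (h1 i))
  have hsum := sum_negMulLog_prod l Finset.univ
  rw [Finset.powerset_univ] at hsum
  have hss : (Matrix.diagonal fun t => (w t : ℂ)) * Matrix.diagonal (fun t => (w t : ℂ)) =
      Matrix.diagonal fun t => ((∏ i, if i ∈ t then l i else 1 - l i : ℝ) : ℂ) := by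
    rw [Matrix.diagonal_mul_diagonal]
    congr 1
    funext t
    rw [← hww, Complex.ofReal_mul]
  refine ⟨Matrix.diagonal fun t => (w t : ℂ), Matrix.diagonal fun t => (-1) ^ t.card,
    Matrix.diagonal fun t => (t.card : ℂ), ⟨?_, ?_, ?_, ?_, ?_, ?_, ?_, ?_, ?_, ?_, ?_⟩, ?_⟩
  · rw [Matrix.diagonal_conjTranspose]
    congr 1; funext t; simp
  · rw [hss, Matrix.trace_diagonal, ← Complex.ofReal_sum, hsum.1, Complex.ofReal_one]
  · rw [Matrix.diagonal_conjTranspose]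
    congr 1; funext t; simp
  · rw [Matrix.diagonal_mul_diagonal, ← Matrix.diagonal_one]
    congr 1; funext t
    rw [← pow_add, ← two_mul, pow_mul]; simp
  · intro i
    rw [diagonal_mul_modeCreation (d' := fun t => -(-1) ^ t.card), ← mul_neg,
      Matrix.diagonal_neg]
    intro s hs
    rw [Finset.card_insert_of_notMem hs, pow_succ]; ring
  · rw [Matrix.diagonal_mul_diagonal, Matrix.diagonal_mul_diagonal]
    congr 1; funext t; exact mul_comm _ _
  · rw [Matrix.diagonal_conjTranspose]
    congr 1; funext t; simp
  · rw [Matrix.diagonal_mul_diagonal, Matrix.diagonal_mul_diagonal]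
    congr 1; funext t; exact mul_comm _ _
  · rw [Matrix.diagonal_mul_diagonal, Matrix.diagonal_mul_diagonal]
    congr 1; funext t; exact mul_comm _ _
  · intro i
    rw [diagonal_mul_modeCreation (d' := fun t => (t.card : ℂ) + 1), ← Matrix.diagonal_add,
      mul_add]
    · simp
    · intro s hs
      rw [Finset.card_insert_of_notMem hs]; push_cast; rfl
  · intro i
    rw [← smul_mul_assoc, ← mul_smul_comm, ← Matrix.diagonal_smul, ← Matrix.diagonal_smul]
    refine diagonal_mul_modeCreation fun t ht => ?_
    simp only [Pi.smul_apply, smul_eq_mul, ← Complex.ofReal_mul]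
    congr 1
    simp only [w]
    rw [← Finset.mul_prod_erase _ _ (Finset.mem_univ i),
      ← Finset.mul_prod_erase _ _ (Finset.mem_univ i), if_pos (Finset.mem_insert_self i t),
      if_neg ht]
    have : ∀ j ∈ Finset.univ.erase i, (if j ∈ insert i t then √(l j) else √(1 - l j)) =
        if j ∈ t then √(l j) else √(1 - l j) := by
      intro j hj
      simp [Finset.ne_of_mem_erase hj]
    rw [Finset.prod_congr rfl this]
    ring
  · rw [hss, vonNeumannEntropy_diagonal, hsum.2]

theorem map_wickMonomial {A B X Y F : Type*} [Monoid A] [Monoid B] [FunLike F A B]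
    [MonoidHomClass F A B] (T : F) (p : X → A) (q : Y → A) {k l : ℕ} (f : Fin k → X)
    (g : Fin l → Y) :
    T (wickMonomial p q f g) = wickMonomial (fun x => T (p x)) (fun y => T (q y)) f g := by
  simp only [wickMonomial, map_mul, map_list_prod, List.map_ofFn]
  rfl

/-- Conjugation with a unitary between index types. -/
def conjHom {n : Type*} [Fintype n] [DecidableEq n] (u : Matrix m n ℂ) (h1 : uᴴ * u = 1)
    (h2 : u * uᴴ = 1) : Matrix n n ℂ →⋆ₐ[ℂ] Matrix m m ℂ where
  toFun y := u * y * uᴴ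
  map_one' := by rw [Matrix.mul_one, h2]
  map_mul' y z := by
    rw [Matrix.mul_assoc (u * y), ← Matrix.mul_assoc uᴴ, ← Matrix.mul_assoc uᴴ, h1,
      Matrix.one_mul]
    simp only [Matrix.mul_assoc]
  map_zero' := by simp
  map_add' y z := by rw [Matrix.mul_add, Matrix.add_mul]
  commutes' r := by
    rw [Algebra.algebraMap_eq_smul_one, Algebra.algebraMap_eq_smul_one, Matrix.mul_smul,
      Matrix.smul_mul, Matrix.mul_one, h2]
  map_star' y := by
    simp [Matrix.star_eq_conjTranspose, Matrix.conjTranspose_mul, Matrix.mul_assoc]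

theorem conjHom_apply {n : Type*} [Fintype n] [DecidableEq n] (u : Matrix m n ℂ) (h1 : uᴴ * u = 1)
    (h2 : u * uᴴ = 1) (y : Matrix n n ℂ) : conjHom u h1 h2 y = u * y * uᴴ := rfl

theorem conjHom_conjTranspose {n : Type*} [Fintype n] [DecidableEq n] (u : Matrix m n ℂ)
    (h1 : uᴴ * u = 1) (h2 : u * uᴴ = 1) (y : Matrix n n ℂ) :
    conjHom u h1 h2 yᴴ = (conjHom u h1 h2 y)ᴴ := map_star (conjHom u h1 h2) y

theorem conjHom_surjective {n : Type*} [Fintype n] [DecidableEq n] (u : Matrix m n ℂ)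
    (h1 : uᴴ * u = 1) (h2 : u * uᴴ = 1) : Function.Surjective (conjHom u h1 h2) := by
  intro y
  refine ⟨uᴴ * y * u, ?_⟩
  rw [conjHom_apply, ← Matrix.mul_assoc, ← Matrix.mul_assoc, h2, Matrix.one_mul,
    Matrix.mul_assoc, h2, Matrix.mul_one]

theorem trace_conjHom {n : Type*} [Fintype n] [DecidableEq n] (u : Matrix m n ℂ)
    (h1 : uᴴ * u = 1) (h2 : u * uᴴ = 1) (y : Matrix n n ℂ) :
    (conjHom u h1 h2 y).trace = y.trace := by
  rw [conjHom_apply, Matrix.trace_mul_comm, ← Matrix.mul_assoc, h1, Matrix.one_mul]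

theorem vonNeumannEntropy_conjHom {n : Type*} [Fintype n] [DecidableEq n] (u : Matrix m n ℂ)
    (h1 : uᴴ * u = 1) (h2 : u * uᴴ = 1) {y : Matrix n n ℂ} (hy : yᴴ = y) :
    vonNeumannEntropy (conjHom u h1 h2 y) = vonNeumannEntropy y := by
  refine vonNeumannEntropy_congr ?_ hy
    ⟨Fintype.card n, Fintype.card m, ?_⟩
  · rw [Matrix.IsHermitian, ← conjHom_conjTranspose, hy]
  · rw [conjHom_apply, Matrix.charpoly_mul_comm', ← Matrix.mul_assoc, h1, Matrix.one_mul]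

variable [Fintype κ] [LinearOrder κ] {a : κ → Matrix m m ℂ}

/-- Functionals on a minimal representation that agree on normal-ordered monomials are equal. -/
theorem IsCAR.ext (ha : IsCAR a) (hcard : Fintype.card m = 2 ^ Fintype.card κ)
    {φ φ' : Matrix m m ℂ →ₗ[ℂ] ℂ}
    (h : ∀ (k l : ℕ) (f : Fin k → κ) (g : Fin l → κ),
      φ (wickMonomial a (fun i => (a i)ᴴ) f g) = φ' (wickMonomial a (fun i => (a i)ᴴ) f g)) :
    φ = φ' := by
  obtain ⟨u, h1, h2, hu⟩ := ha.exists_unitary hcard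
  have key : φ.comp (conjHom u h1 h2).toAlgHom.toLinearMap =
      φ'.comp (conjHom u h1 h2).toAlgHom.toLinearMap := by
    refine modeCreation_ext fun k l f g => ?_
    have hT : conjHom u h1 h2 (wickMonomial modeCreation (fun i => (modeCreation i)ᴴ) f g) =
        wickMonomial a (fun i => (a i)ᴴ) f g := by
      rw [map_wickMonomial]
      have hT : ∀ i, conjHom u h1 h2 (modeCreation i) = a i := hu
      simp only [conjHom_conjTranspose, hT]
    change φ (conjHom u h1 h2 _) = φ' (conjHom u h1 h2 _)
    rw [hT, h]
  refine LinearMap.ext fun y => ?_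
  obtain ⟨z, rfl⟩ := conjHom_surjective u h1 h2 y
  exact LinearMap.congr_fun key z

/-- All relations are algebraic and so carry over from Fock space along the unitary equivalence. -/
theorem IsCAR.exists_isGaussianRoot (ha : IsCAR a)
    (hcard : Fintype.card m = 2 ^ Fintype.card κ) {l : κ → ℝ}
    (hl0 : ∀ i, 0 ≤ l i) (hl1 : ∀ i, l i ≤ 1) :
    ∃ s G N : Matrix m m ℂ, IsGaussianRoot a l s G N ∧
      vonNeumannEntropy (s * s) =
        ∑ i, (Real.negMulLog (l i) + Real.negMulLog (1 - l i)) := by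
  obtain ⟨u, h1, h2, hu⟩ := ha.exists_unitary hcard
  obtain ⟨s, G, N, h, hS⟩ := exists_isGaussianRoot_modeCreation hl0 hl1
  have hT : ∀ i, conjHom u h1 h2 (modeCreation i) = a i := hu
  refine ⟨conjHom u h1 h2 s, conjHom u h1 h2 G, conjHom u h1 h2 N,
    ⟨?_, ?_, ?_, ?_, ?_, ?_, ?_, ?_, ?_, ?_, ?_⟩, ?_⟩
  · rw [← conjHom_conjTranspose, h.conjTranspose_eq]
  · rw [← map_mul, trace_conjHom, h.trace_mul_self]
  · rw [← conjHom_conjTranspose, h.parity_conjTranspose]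
  · rw [← map_mul, h.parity_mul_self, map_one]
  · intro i; rw [← hT, ← map_mul, h.parity_anticomm, map_neg, map_mul]
  · rw [← map_mul, h.parity_comm, map_mul]
  · rw [← conjHom_conjTranspose, h.number_conjTranspose]
  · rw [← map_mul, h.number_comm, map_mul]
  · rw [← map_mul, h.number_parity, map_mul]
  · intro i; rw [← hT, ← map_mul, h.number_mul, map_add, map_mul]
  · intro i; rw [← hT, ← map_mul, ← map_smul, h.mul_creation, map_smul, map_mul]
  · rw [← map_mul, vonNeumannEntropy_conjHom _ _ _ _, hS]
    rw [Matrix.conjTranspose_mul, h.conjTranspose_eq]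

end ModeStates

/-! ### Wick's theorem for density matrices -/

section DensityWick

variable {m X : Type*} [Fintype m] [DecidableEq m]

/-- Cyclicity of the trace turns the exchange relation `hD` into the hypothesis on the functional in
`wick_det`. -/
theorem traceForm_wick_det {D : Matrix m m ℂ} (p p' : X → Matrix m m ℂ) (τ : X → X → ℂ)
    (hp : ∀ x x', p' x * p x' + p x' * p' x = 0)
    (hq : ∀ y x, (p y)ᴴ * p' x + p' x * (p y)ᴴ = τ y x • (1 : Matrix m m ℂ))
    (hD : ∀ x, D * p x = D * p' x + p' x * D) (h1 : D.trace = 1) (k : ℕ) (f g : Fin k → X) :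
    traceForm D (wickMonomial p (fun x => (p x)ᴴ) f g) =
      Matrix.det (Matrix.of fun i j => τ (g i) (f j)) := by
  refine wick_det _ _ p' _ τ (fun x x' => eq_neg_of_add_eq_zero_left (hp x x')) hq
    (fun x z => ?_) (by rw [traceForm_apply, mul_one, h1]) k f g
  simp only [traceForm_apply]
  rw [← mul_assoc, hD, add_mul, mul_add, Matrix.trace_add, Matrix.trace_add, ← mul_assoc,
    ← mul_assoc D z, Matrix.trace_mul_cycle D z]

theorem traceForm_wick_zero {D N : Matrix m m ℂ} (p : X → Matrix m m ℂ) (hN : Nᴴ = N)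
    (hp : ∀ x, N * p x = p x * N + p x) (hD : N * D = D * N) {k l : ℕ} (hkl : k ≠ l)
    (f : Fin k → X) (g : Fin l → X) :
    traceForm D (wickMonomial p (fun x => (p x)ᴴ) f g) = 0 := by
  refine wick_zero _ _ _ N hp (fun x => ?_) (fun z => ?_) hkl f g
  · have := congrArg Matrix.conjTranspose (hp x)
    rw [Matrix.conjTranspose_add, Matrix.conjTranspose_mul, Matrix.conjTranspose_mul, hN] at this
    exact eq_sub_of_add_eq this.symm
  · simp only [traceForm_apply]
    rw [← mul_assoc, ← mul_assoc, Matrix.trace_mul_comm (D * z), ← mul_assoc, hD]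

end DensityWick

/-! ### Creation operators on Fock space -/

section Creation

variable {H : Type*} [NormedAddCommGroup H] [InnerProductSpace ℂ H]
variable {ι : Type*} [Fintype ι] [LinearOrder ι] (b : OrthonormalBasis ι ℂ H)

theorem creation_add (f g : H) : creation b (f + g) = creation b f + creation b g := by
  simp [creation, add_smul, Finset.sum_add_distrib]

theorem creation_smul (r : ℂ) (f : H) : creation b (r • f) = r • creation b f := by
  simp [creation, Finset.smul_sum, smul_smul]

/-- The creation operator as a linear map. -/
def creationₗ : H →ₗ[ℂ] FockMatrix ι where
  toFun := creation b
  map_add' := creation_add b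
  map_smul' := creation_smul b

theorem creation_basis (i : ι) : creation b (b i) = modeCreation i := by
  simp [creation]

theorem creation_anticomm (f g : H) :
    creation b f * creation b g + creation b g * creation b f = 0 := by
  simp only [creation, Finset.sum_mul_sum, smul_mul_smul_comm]
  rw [Finset.sum_comm (γ := ι), ← Finset.sum_add_distrib]
  refine Finset.sum_eq_zero fun i _ => ?_
  rw [← Finset.sum_add_distrib]
  refine Finset.sum_eq_zero fun j _ => ?_
  rw [mul_comm (b.repr f j), ← smul_add, modeCreation_anticomm, smul_zero]

theorem creation_mul_comm_neg (f g : H) :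
    creation b f * creation b g = -(creation b g * creation b f) :=
  eq_neg_of_add_eq_zero_left (creation_anticomm b f g)

theorem annihilation_eq (f : H) :
    annihilation b f = ∑ i, star (b.repr f i) • (modeCreation i)ᴴ := by
  simp [annihilation, creation, Matrix.conjTranspose_sum]

theorem annihilation_creation_anticomm (g f : H) :
    annihilation b g * creation b f + creation b f * annihilation b g = inner ℂ g f • 1 := by
  rw [annihilation_eq]
  simp only [creation, Finset.sum_mul_sum, smul_mul_smul_comm]
  rw [Finset.sum_comm (γ := ι), ← Finset.sum_add_distrib, ← b.repr.inner_map_map g f,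
    PiLp.inner_apply, Finset.sum_smul]
  refine Finset.sum_congr rfl fun i _ => ?_
  rw [← Finset.sum_add_distrib, Finset.sum_eq_single i]
  · rw [mul_comm (b.repr f i), ← smul_add, conjTranspose_modeCreation_anticomm, if_pos rfl]
    simp [mul_comm]
  · intro j _ hj
    rw [mul_comm (b.repr f i), ← smul_add, conjTranspose_modeCreation_anticomm, if_neg hj,
      smul_zero]
  · simp

theorem isCAR_creation {κ : Type*} [Fintype κ] [DecidableEq κ] (e : OrthonormalBasis κ ℂ H) :
    IsCAR fun i => creation b (e i) where
  anticomm i j := creation_anticomm b _ _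
  anticomm_conjTranspose i j := by
    have := annihilation_creation_anticomm b (e i) (e j)
    rw [annihilation] at this
    rw [this, orthonormal_iff_ite.1 e.orthonormal]
    split_ifs <;> simp

omit [LinearOrder ι] in
theorem card_finset_eq {κ : Type*} [Fintype κ] (b : OrthonormalBasis ι ℂ H)
    (e : OrthonormalBasis κ ℂ H) : Fintype.card (Finset ι) = 2 ^ Fintype.card κ := by
  rw [Fintype.card_finset, ← Module.finrank_eq_card_basis b.toBasis,
    ← Module.finrank_eq_card_basis e.toBasis]

end Creation

/-! ### Square roots of symbols -/

section Sqrt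

variable {H : Type*} [NormedAddCommGroup H] [InnerProductSpace ℂ H] [CompleteSpace H]

theorem star_sqrt (T : H →L[ℂ] H) : star (CFC.sqrt T) = CFC.sqrt T :=
  IsSelfAdjoint.of_nonneg (CFC.sqrt_nonneg T)

theorem inner_sqrt_left (T : H →L[ℂ] H) (x y : H) :
    inner ℂ (CFC.sqrt T x) y = inner ℂ x (CFC.sqrt T y) := by
  conv_lhs => rw [← star_sqrt T, ContinuousLinearMap.star_eq_adjoint]
  rw [ContinuousLinearMap.adjoint_inner_left]

theorem sqrt_apply_sqrt_apply {T : H →L[ℂ] H} (hT : 0 ≤ T) (x : H) :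
    CFC.sqrt T (CFC.sqrt T x) = T x := by
  conv_rhs => rw [← CFC.sqrt_mul_sqrt_self T hT]
  rfl

/-- For `l > 0` the difference `x` of the two sides satisfies `√T x = -√l x`, which positivity of
`√T` allows only for `x = 0`. For `l = 0`, `‖√T e‖² = ⟨e, T e⟩ = 0`. -/
theorem sqrt_apply_of_eigen {T : H →L[ℂ] H} (hT : 0 ≤ T) {l : ℝ} (hl : 0 ≤ l) {e : H}
    (he : T e = (l : ℂ) • e) : CFC.sqrt T e = (√l : ℂ) • e := by
  rcases hl.eq_or_lt with rfl | hl
  · have : inner ℂ (CFC.sqrt T e) (CFC.sqrt T e) = 0 := by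
      rw [inner_sqrt_left, sqrt_apply_sqrt_apply hT, he]; simp
    simpa using this
  · set x : H := CFC.sqrt T e - (√l : ℂ) • e with hx
    have h1 : CFC.sqrt T x + (√l : ℂ) • x = 0 := by
      have h2 : ((√l : ℝ) : ℂ) * (√l : ℝ) = (l : ℝ) := by
        rw [← Complex.ofReal_mul, Real.mul_self_sqrt hl.le]
      rw [hx, map_sub, map_smul, sqrt_apply_sqrt_apply hT, he, smul_sub, smul_smul, h2]
      abel
    have h2 : 0 ≤ inner ℂ x (CFC.sqrt T x) :=
      ((ContinuousLinearMap.nonneg_iff_isPositive _).1 (CFC.sqrt_nonneg T)).inner_nonneg_right x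
    have h3 : inner ℂ x (CFC.sqrt T x) + (√l : ℂ) * inner ℂ x x = 0 := by
      rw [← inner_smul_right, ← inner_add_right, h1, inner_zero_right]
    have h4 : (0 : ℂ) ≤ inner ℂ x x := by
      rw [inner_self_eq_norm_sq_to_K]
      change (0 : ℂ) ≤ (‖x‖ : ℂ) ^ 2
      rw [← Complex.ofReal_pow]
      exact Complex.zero_le_real.2 (sq_nonneg _)
    have h5 : (0 : ℂ) < (√l : ℝ) := by exact_mod_cast Real.sqrt_pos.2 hl
    have h6 : (√l : ℂ) * inner ℂ x x = 0 :=
      le_antisymm (by rw [← h3]; exact le_add_of_nonneg_left h2) (mul_nonneg h5.le h4)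
    have h7 : x = 0 := inner_self_eq_zero.1 ((mul_eq_zero.1 h6).resolve_left h5.ne')
    exact sub_eq_zero.1 h7

variable [FiniteDimensional ℂ H]

omit [CompleteSpace H] in
theorem IsSymbol.exists_eigenbasis {Q : H →L[ℂ] H} (hQ : IsSymbol Q) :
    ∃ (e : OrthonormalBasis (Fin (Module.finrank ℂ H)) ℂ H)
      (l : Fin (Module.finrank ℂ H) → ℝ), ∀ i, Q (e i) = (l i : ℂ) • e i := by
  have hs : Q.toLinearMap.IsSymmetric :=
    ((ContinuousLinearMap.nonneg_iff_isPositive _).1 hQ.1).isSymmetric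
  exact ⟨hs.eigenvectorBasis rfl, hs.eigenvalues rfl, fun i => hs.apply_eigenvectorBasis rfl i⟩

omit [CompleteSpace H] [FiniteDimensional ℂ H] in
theorem IsSymbol.eigenvalue_mem {Q : H →L[ℂ] H} (hQ : IsSymbol Q) {e : H} (he : ‖e‖ = 1) {l : ℝ}
    (h : Q e = (l : ℂ) • e) : 0 ≤ l ∧ l ≤ 1 := by
  have h1 : (inner ℂ e e : ℂ) = 1 := by rw [inner_self_eq_norm_sq_to_K, he]; simp
  have h2 := ((ContinuousLinearMap.nonneg_iff_isPositive _).1 hQ.1).inner_nonneg_right e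
  have h3 := ((ContinuousLinearMap.le_def _ _).1 hQ.2).inner_nonneg_right e
  rw [h, inner_smul_right, h1, mul_one] at h2
  rw [_root_.sub_apply, h, inner_sub_right, inner_smul_right,
    one_apply_eq_self, h1, mul_one] at h3
  refine ⟨by exact_mod_cast h2, ?_⟩
  have : (0 : ℂ) ≤ ((1 - l : ℝ) : ℂ) := by push_cast; exact h3
  linarith [show (0 : ℝ) ≤ 1 - l by exact_mod_cast this]

/-- All three square roots are diagonal in an eigenbasis of `Q`. -/
theorem IsSymbol.sqrtVar_apply {Q : H →L[ℂ] H} (hQ : IsSymbol Q) (x : H) :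
    sqrtVar Q x = CFC.sqrt Q (CFC.sqrt (1 - Q) x) ∧
      sqrtVar Q x = CFC.sqrt (1 - Q) (CFC.sqrt Q x) := by
  obtain ⟨e, l, he⟩ := hQ.exists_eigenbasis
  have hl := fun i => hQ.eigenvalue_mem (e.orthonormal.1 i) (he i)
  have he' : ∀ i, (1 - Q) (e i) = ((1 - l i : ℝ) : ℂ) • e i := fun i => by
    simp [he, sub_smul]
  have hT : 0 ≤ Q * (1 - Q) := (Commute.one_right Q).sub_right (Commute.refl Q) |>.mul_nonneg
    hQ.1 (sub_nonneg.2 hQ.2)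
  have heT : ∀ i, (Q * (1 - Q)) (e i) = ((l i * (1 - l i) : ℝ) : ℂ) • e i := fun i => by
    rw [mul_apply_eq_comp, he', map_smul, he, smul_smul, ← Complex.ofReal_mul,
      mul_comm]
  have h0 : ∀ i, 0 ≤ 1 - l i := fun i => sub_nonneg.2 (hl i).2
  have key : ∀ i, sqrtVar Q (e i) = ((√(l i) * √(1 - l i) : ℝ) : ℂ) • e i := fun i => by
    rw [sqrtVar, sqrt_apply_of_eigen hT (mul_nonneg (hl i).1 (h0 i)) (heT i),
      Real.sqrt_mul (hl i).1]
  have hQs := fun i => sqrt_apply_of_eigen hQ.1 (hl i).1 (he i)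
  have hQs' := fun i => sqrt_apply_of_eigen (sub_nonneg.2 hQ.2) (h0 i) (he' i)
  constructor
  · refine LinearMap.congr_fun (f := (sqrtVar Q).toLinearMap)
      (g := (CFC.sqrt Q * CFC.sqrt (1 - Q)).toLinearMap) (e.toBasis.ext fun i => ?_) x
    change sqrtVar Q (e i) = CFC.sqrt Q (CFC.sqrt (1 - Q) (e i))
    rw [key, hQs', map_smul, hQs, smul_smul, mul_comm, Complex.ofReal_mul]
  · refine LinearMap.congr_fun (f := (sqrtVar Q).toLinearMap)
      (g := (CFC.sqrt (1 - Q) * CFC.sqrt Q).toLinearMap) (e.toBasis.ext fun i => ?_) x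
    change sqrtVar Q (e i) = CFC.sqrt (1 - Q) (CFC.sqrt Q (e i))
    rw [key, hQs, map_smul, hQs', smul_smul, Complex.ofReal_mul]

end Sqrt

/-! ### Density matrices of quasi-free states -/

section Gaussian

variable {H : Type*} [NormedAddCommGroup H] [InnerProductSpace ℂ H] [CompleteSpace H]
variable {ι : Type*} [Fintype ι] [LinearOrder ι]

/-- `s` is the square root of the density matrix of the gauge-invariant quasi-free state with
symbol `Q`, `G` is the parity and `N` the number operator. -/
structure IsGaussian (b : OrthonormalBasis ι ℂ H) (Q : H →L[ℂ] H) (s G N : FockMatrix ι) :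
    Prop where
  conjTranspose_eq : sᴴ = s
  trace_mul_self : (s * s).trace = 1
  parity_conjTranspose : Gᴴ = G
  parity_mul_self : G * G = 1
  parity_anticomm : ∀ f, G * creation b f = -(creation b f * G)
  parity_comm : G * s = s * G
  number_conjTranspose : Nᴴ = N
  number_comm : N * s = s * N
  number_parity : N * G = G * N
  number_mul : ∀ f, N * creation b f = creation b f * N + creation b f
  mul_creation : ∀ f, s * creation b (CFC.sqrt (1 - Q) f) = creation b (CFC.sqrt Q f) * s

variable [FiniteDimensional ℂ H] (b : OrthonormalBasis ι ℂ H) {Q : H →L[ℂ] H}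

omit [FiniteDimensional ℂ H] in
-- The operators `creation b (e i)` are again CAR modes. The relations are linear in `f`, so they
-- need checking only on the eigenbasis.
theorem IsSymbol.exists_isGaussian (hQ : IsSymbol Q) {κ : Type*} [Fintype κ] [LinearOrder κ]
    (e : OrthonormalBasis κ ℂ H) (l : κ → ℝ) (he : ∀ i, Q (e i) = (l i : ℂ) • e i) :
    ∃ s G N : FockMatrix ι, IsGaussian b Q s G N ∧
      vonNeumannEntropy (s * s) =
        ∑ i, (Real.negMulLog (l i) + Real.negMulLog (1 - l i)) := by
  have hl := fun i => hQ.eigenvalue_mem (e.orthonormal.1 i) (he i)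
  have he' : ∀ i, (1 - Q) (e i) = ((1 - l i : ℝ) : ℂ) • e i := fun i => by
    simp [he, sub_smul]
  have hQs := fun i => sqrt_apply_of_eigen hQ.1 (hl i).1 (he i)
  have hQs' := fun i => sqrt_apply_of_eigen (sub_nonneg.2 hQ.2) (sub_nonneg.2 (hl i).2) (he' i)
  obtain ⟨s, G, N, h, hS⟩ := (isCAR_creation b e).exists_isGaussianRoot (card_finset_eq b e)
    (fun i => (hl i).1) (fun i => (hl i).2)
  refine ⟨s, G, N, ⟨h.conjTranspose_eq, h.trace_mul_self, h.parity_conjTranspose,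
    h.parity_mul_self, fun f => ?_, h.parity_comm, h.number_conjTranspose, h.number_comm,
    h.number_parity, fun f => ?_, fun f => ?_⟩, hS⟩
  · refine LinearMap.congr_fun (f := (LinearMap.mulLeft ℂ G).comp (creationₗ b))
      (g := -(LinearMap.mulRight ℂ G).comp (creationₗ b)) (e.toBasis.ext fun i => ?_) f
    simpa [creationₗ] using h.parity_anticomm i
  · refine LinearMap.congr_fun (f := (LinearMap.mulLeft ℂ N).comp (creationₗ b))
      (g := (LinearMap.mulRight ℂ N).comp (creationₗ b) + creationₗ b)
      (e.toBasis.ext fun i => ?_) f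
    simpa [creationₗ] using h.number_mul i
  · refine LinearMap.congr_fun
      (f := (LinearMap.mulLeft ℂ s).comp ((creationₗ b).comp (CFC.sqrt (1 - Q)).toLinearMap))
      (g := (LinearMap.mulRight ℂ s).comp ((creationₗ b).comp (CFC.sqrt Q).toLinearMap))
      (e.toBasis.ext fun i => ?_) f
    change s * creation b (CFC.sqrt (1 - Q) (e i)) = creation b (CFC.sqrt Q (e i)) * s
    rw [hQs, hQs', creation_smul, creation_smul, mul_smul_comm, smul_mul_assoc]
    exact h.mul_creation i

variable {b} {s G N : FockMatrix ι}

/-- Split `f = Q f + (1 - Q) f`. In the second part each of the two factors `s` that is passed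
exchanges one `√(1-Q)` for `√Q`. -/
theorem IsGaussian.mul_self_mul_creation (h : IsGaussian b Q s G N) (hQ : IsSymbol Q) (f : H) :
    s * s * creation b f = s * s * creation b (Q f) + creation b (Q f) * (s * s) := by
  have h1 : f = Q f + CFC.sqrt (1 - Q) (CFC.sqrt (1 - Q) f) := by
    rw [sqrt_apply_sqrt_apply (sub_nonneg.2 hQ.2)]; simp
  conv_lhs => rw [h1]
  rw [creation_add, mul_add, mul_assoc s s (creation b (CFC.sqrt (1 - Q) _)), h.mul_creation,
    ← (hQ.sqrtVar_apply f).1, (hQ.sqrtVar_apply f).2, ← mul_assoc s, h.mul_creation,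
    sqrt_apply_sqrt_apply hQ.1]
  simp only [mul_assoc]

theorem IsGaussian.isQuasiFreeState (h : IsGaussian b Q s G N) (hQ : IsSymbol Q) :
    IsQuasiFreeState b Q (traceForm (s * s)) where
  isSymbol := hQ
  isState := isState_traceForm h.conjTranspose_eq h.trace_mul_self
  apply_eq_det k f g := traceForm_wick_det (creation b) (fun f => creation b (Q f))
    (fun g f => inner ℂ g (Q f)) (fun _ _ => creation_anticomm b _ _)
    (fun _ _ => annihilation_creation_anticomm b _ _) (h.mul_self_mul_creation hQ)
    h.trace_mul_self k f g
  apply_eq_zero k l f g hkl := by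
    refine traceForm_wick_zero (creation b) h.number_conjTranspose h.number_mul ?_ hkl f g
    rw [← mul_assoc, h.number_comm, mul_assoc, h.number_comm, mul_assoc]

/-- A quasi-free state is determined by its symbol. -/
theorem IsQuasiFreeState.unique {ω ω' : FockMatrix ι →ₗ[ℂ] ℂ} {H : Type*} [NormedAddCommGroup H]
    [InnerProductSpace ℂ H] {b : OrthonormalBasis ι ℂ H} {Q : H →L[ℂ] H}
    (h : IsQuasiFreeState b Q ω) (h' : IsQuasiFreeState b Q ω') : ω = ω' := by
  refine modeCreation_ext fun k l f g => ?_
  have hm : wickMonomial modeCreation (fun i => (modeCreation i)ᴴ) f g =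
      normalMonomial b (fun i => b (f i)) (fun j => b (g j)) := by
    simp only [normalMonomial, wickMonomial, annihilation, creation_basis]
  rw [hm]
  by_cases hkl : k = l
  · subst hkl
    rw [h.apply_eq_det, h'.apply_eq_det]
  · rw [h.apply_eq_zero _ _ _ _ hkl, h'.apply_eq_zero _ _ _ _ hkl]

end Gaussian

/-! ### Expansion of products of anticommuting sums -/

section Expansion

variable {A : Type*} [Ring A] [Algebra ℂ A]

theorem mul_list_prod_of_anticomm {α : Type*} (G : A) (z : α → A) (hz : ∀ i, G * z i = -(z i * G))
    (l : List α) : G * (l.map z).prod = (-1 : ℂ) ^ l.length • ((l.map z).prod * G) := by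
  induction l with
  | nil => simp
  | cons i l ih =>
    rw [List.map_cons, List.prod_cons, ← mul_assoc, hz, neg_mul, mul_assoc, ih, List.length_cons,
      pow_succ, mul_smul_comm, mul_assoc]
    simp

variable {N : ℕ}

/-- The sign of the shuffle that moves `S` in front, among the positions of a list. -/
def listShuffleSign (l : List (Fin N)) (S : Finset (Fin N)) : ℂ :=
  (-1) ^ (Finset.univ.filter
    (fun p : Fin N × Fin N => p.1 ∈ l ∧ p.1 ∉ S ∧ p.2 ∈ S ∧ p.1 < p.2)).card

/-- All of `S` has to pass `i`, which costs one sign for each of its elements. -/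
theorem listShuffleSign_cons_of_notMem {i : Fin N} {l : List (Fin N)} {S : Finset (Fin N)}
    (hi : i ∉ l) (hS : i ∉ S) (hlt : ∀ j ∈ S, i < j) :
    listShuffleSign (i :: l) S = (-1) ^ S.card * listShuffleSign l S := by
  unfold listShuffleSign
  rw [← pow_add]
  congr 1
  have : (Finset.univ.filter (fun p : Fin N × Fin N => p.1 ∈ i :: l ∧ p.1 ∉ S ∧ p.2 ∈ S ∧
      p.1 < p.2)) = S.map ⟨fun j => (i, j), Prod.mk_right_injective i⟩ ∪
      (Finset.univ.filter (fun p : Fin N × Fin N => p.1 ∈ l ∧ p.1 ∉ S ∧ p.2 ∈ S ∧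
        p.1 < p.2)) := by
    ext ⟨p, q⟩
    simp only [Finset.mem_filter, Finset.mem_univ, true_and, List.mem_cons, Finset.mem_union,
      Finset.mem_map, Function.Embedding.coeFn_mk, Prod.mk.injEq]
    constructor
    · rintro ⟨rfl | h1, h2, h3, h4⟩
      · exact Or.inl ⟨q, h3, rfl, rfl⟩
      · exact Or.inr ⟨h1, h2, h3, h4⟩
    · rintro (⟨j, hj, rfl, rfl⟩ | ⟨h1, h2, h3, h4⟩)
      · exact ⟨Or.inl rfl, hS, hj, hlt j hj⟩
      · exact ⟨Or.inr h1, h2, h3, h4⟩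
  rw [this, Finset.card_union_of_disjoint, Finset.card_map]
  rw [Finset.disjoint_left]
  rintro ⟨p, q⟩ h1 h2
  simp only [Finset.mem_map, Function.Embedding.coeFn_mk, Prod.mk.injEq, Finset.mem_filter] at h1 h2
  obtain ⟨j, _, rfl, _⟩ := h1
  exact hi h2.2.1

theorem listShuffleSign_cons_insert {i : Fin N} {l : List (Fin N)} {S : Finset (Fin N)}
    (hlt : ∀ j ∈ l, i < j) :
    listShuffleSign (i :: l) (insert i S) = listShuffleSign l S := by
  unfold listShuffleSign
  congr 2
  ext ⟨p, q⟩
  simp only [Finset.mem_filter, Finset.mem_univ, true_and, List.mem_cons, Finset.mem_insert]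
  constructor
  · rintro ⟨rfl | h1, h2, rfl | h3, h4⟩
    · tauto
    · tauto
    · exact absurd (hlt _ h1) h4.not_gt
    · tauto
  · rintro ⟨h1, h2, h3, h4⟩
    refine ⟨Or.inr h1, ?_, Or.inr h3, h4⟩
    rintro (rfl | h)
    · exact lt_irrefl _ (hlt _ h1)
    · exact h2 h

/-- Let `S` be the set of factors from which `Z i` is chosen. Each remaining `G * Y i` moves right
past the later `Z j`; `Y i` commutes and `G` changes the sign, which produces exactly the shuffle
sign. -/
theorem list_prod_add_mul (Z Y : Fin N → A) (G : A) (hGZ : ∀ i, G * Z i = -(Z i * G))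
    (hGY : ∀ i, G * Y i = Y i * G) (hYZ : ∀ i j, Y i * Z j = Z j * Y i) (l : List (Fin N))
    (hl : l.SortedLT) :
    (l.map fun i => Z i + G * Y i).prod =
      ∑ S ∈ l.toFinset.powerset, listShuffleSign l S •
        (((l.filter (· ∈ S)).map Z).prod * G ^ (l.filter (· ∉ S)).length *
          ((l.filter (· ∉ S)).map Y).prod) := by
  induction l with
  | nil => simp [listShuffleSign]
  | cons i l ih =>
    have hp := List.pairwise_cons.1 hl.pairwise
    have hil : i ∉ l := fun h => lt_irrefl _ (hp.1 i h)
    have hnd : l.Nodup := hp.2.sortedLT.nodup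
    rw [List.map_cons, List.prod_cons, ih hp.2.sortedLT, List.toFinset_cons,
      Finset.sum_powerset_insert (by simpa using hil), add_mul, add_comm, Finset.mul_sum,
      Finset.mul_sum]
    congr 1
    · refine Finset.sum_congr rfl fun S hS => ?_
      have hS' : ∀ j ∈ S, j ∈ l := fun j hj => List.mem_toFinset.1 (Finset.mem_powerset.1 hS hj)
      have hiS : i ∉ S := fun h => hil (hS' i h)
      have hcard : (l.filter (· ∈ S)).length = S.card := by
        rw [← List.toFinset_card_of_nodup (hnd.filter _)]
        congr 1
        ext j
        simpa using hS' j
      have hZS : ∀ L : List (Fin N), Y i * (L.map Z).prod = (L.map Z).prod * Y i := by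
        intro L
        induction L with
        | nil => simp
        | cons j L ihL => rw [List.map_cons, List.prod_cons, ← mul_assoc, hYZ, mul_assoc, ihL,
            mul_assoc]
      have hGp : ∀ k : ℕ, Y i * G ^ k = G ^ k * Y i := fun k =>
        (Commute.pow_right (hGY i).symm k)
      rw [listShuffleSign_cons_of_notMem hil hiS fun j hj => hp.1 j (hS' j hj),
        List.filter_cons_of_neg (by simpa using hiS), List.filter_cons_of_pos (by simpa using hiS),
        List.map_cons, List.prod_cons, List.length_cons, mul_smul_comm, mul_smul, smul_comm,
        ← hcard]
      congr 1
      rw [mul_assoc G, ← mul_assoc (Y i), ← mul_assoc (Y i), hZS, mul_assoc _ (Y i), hGp,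
        ← mul_assoc G, ← mul_assoc G, mul_list_prod_of_anticomm G Z hGZ]
      simp only [smul_mul_assoc, mul_assoc, pow_succ']
    · refine Finset.sum_congr rfl fun S hS => ?_
      have hS' : ∀ j ∈ S, j ∈ l := fun j hj => List.mem_toFinset.1 (Finset.mem_powerset.1 hS hj)
      have hf : ∀ j ∈ l, (j ∈ insert i S ↔ j ∈ S) := by
        intro j hj
        have : j ≠ i := by rintro rfl; exact hil hj
        simp [this]
      have hf1 : l.filter (· ∈ insert i S) = l.filter (· ∈ S) :=
        List.filter_congr fun j hj => by simp only [hf j hj]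
      have hf2 : l.filter (· ∉ insert i S) = l.filter (· ∉ S) :=
        List.filter_congr fun j hj => by simp only [hf j hj]
      rw [listShuffleSign_cons_insert hp.1, List.filter_cons_of_pos (by simp),
        List.filter_cons_of_neg (by simp), hf1, hf2, List.map_cons, List.prod_cons, mul_smul_comm]
      simp only [mul_assoc]

theorem finRange_prod_add_mul (Z Y : Fin N → A) (G : A) (hGZ : ∀ i, G * Z i = -(Z i * G))
    (hGY : ∀ i, G * Y i = Y i * G) (hYZ : ∀ i j, Y i * Z j = Z j * Y i) :
    ((List.finRange N).map fun i => Z i + G * Y i).prod =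
      ∑ S : Finset (Fin N), shuffleSign S •
        (orderedProd S Z * G ^ ((List.finRange N).filter (· ∈ Sᶜ)).length * orderedProd Sᶜ Y) := by
  rw [list_prod_add_mul Z Y G hGZ hGY hYZ _ (List.sortedLT_finRange N), List.toFinset_finRange,
    Finset.powerset_univ]
  refine Finset.sum_congr rfl fun S _ => ?_
  simp [listShuffleSign, shuffleSign, orderedProd]

end Expansion

/-! ### Left and right multiplication on matrices -/

section Bimodule

variable {m : Type*} [Fintype m] [DecidableEq m]

/-- The operator `X ↦ y X z` on matrices. -/
def bimul (z y : Matrix m m ℂ) : Matrix (m × m) (m × m) ℂ := zᵀ ⊗ₖ y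

omit [DecidableEq m] in
theorem bimul_mul (z y z' y' : Matrix m m ℂ) :
    bimul z y * bimul z' y' = bimul (z' * z) (y * y') := by
  rw [bimul, bimul, bimul, ← Matrix.mul_kronecker_mul, Matrix.transpose_mul]

omit [DecidableEq m] [Fintype m] in
theorem conjTranspose_bimul (z y : Matrix m m ℂ) : (bimul z y)ᴴ = bimul zᴴ yᴴ := by
  rw [bimul, bimul, Matrix.conjTranspose_kronecker]
  rfl

omit [DecidableEq m] in
theorem bimul_mulVec_vec (z y x : Matrix m m ℂ) :
    bimul z y *ᵥ Matrix.vec x = Matrix.vec (y * x * z) := by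
  rw [bimul, Matrix.kronecker_mulVec_vec, Matrix.transpose_transpose]

omit [Fintype m] in
theorem bimul_one_one : bimul (1 : Matrix m m ℂ) 1 = 1 := by
  rw [bimul, Matrix.transpose_one, Matrix.one_kronecker_one]

omit [DecidableEq m] [Fintype m] in
theorem bimul_add_right (z y y' : Matrix m m ℂ) : bimul z (y + y') = bimul z y + bimul z y' :=
  Matrix.kronecker_add _ _ _

omit [DecidableEq m] [Fintype m] in
theorem bimul_add_left (z z' y : Matrix m m ℂ) : bimul (z + z') y = bimul z y + bimul z' y := by
  rw [bimul, Matrix.transpose_add, Matrix.add_kronecker]; rfl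

omit [DecidableEq m] [Fintype m] in
theorem bimul_neg_right (z y : Matrix m m ℂ) : bimul z (-y) = -bimul z y := by
  ext; simp [bimul]

omit [DecidableEq m] [Fintype m] in
theorem bimul_neg_left (z y : Matrix m m ℂ) : bimul (-z) y = -bimul z y := by
  ext; simp [bimul]

omit [DecidableEq m] [Fintype m] in
theorem bimul_smul_right (r : ℂ) (z y : Matrix m m ℂ) : bimul z (r • y) = r • bimul z y :=
  Matrix.kronecker_smul _ _ _

omit [DecidableEq m] [Fintype m] in
theorem bimul_smul_left (r : ℂ) (z y : Matrix m m ℂ) : bimul (r • z) y = r • bimul z y := by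
  rw [bimul, Matrix.transpose_smul, Matrix.smul_kronecker]; rfl

omit [DecidableEq m] in
theorem trace_vecMulVec_mul (v : m → ℂ) (X : Matrix m m ℂ) :
    (Matrix.vecMulVec v (star v) * X).trace = star v ⬝ᵥ X *ᵥ v := by
  rw [Matrix.vecMulVec_mul, Matrix.trace_vecMulVec, dotProduct_comm, Matrix.dotProduct_mulVec]

omit [DecidableEq m] in
theorem star_vec_dotProduct_bimul (z y x : Matrix m m ℂ) :
    star (Matrix.vec x) ⬝ᵥ bimul z y *ᵥ Matrix.vec x = (xᴴ * (y * x * z)).trace := by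
  rw [bimul_mulVec_vec, Matrix.star_vec_dotProduct_vec]

end Bimodule

/-! ### The purified quasi-free state -/

section Double

variable {H : Type*} [NormedAddCommGroup H] [InnerProductSpace ℂ H] [CompleteSpace H]
variable {ι : Type*} [Fintype ι] [LinearOrder ι] {b : OrthonormalBasis ι ℂ H} {Q : H →L[ℂ] H}
  {s G N : FockMatrix ι}

/-- The creation operators over `H ⊕ H` on the Hilbert-Schmidt operators on Fock space, for a
parity operator `G`. -/
def doubleCreation (b : OrthonormalBasis ι ℂ H) (G : FockMatrix ι) (u k : H) :
    Matrix (Finset ι × Finset ι) (Finset ι × Finset ι) ℂ :=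
  -- This is `X ↦ a*(u) X G + X G a*(k)`. Left and right multiplications commute, and the factors
  -- `G` make the two summands anticommute.
  bimul G (creation b u) + bimul (G * creation b k) 1

omit [CompleteSpace H] in
theorem doubleCreation_add (u k u' k' : H) :
    doubleCreation b G (u + u') (k + k') = doubleCreation b G u k + doubleCreation b G u' k' := by
  simp only [doubleCreation, creation_add, bimul_add_right, mul_add, bimul_add_left]
  abel

theorem IsGaussian.parity_anticomm_annihilation (h : IsGaussian b Q s G N) (f : H) :
    G * annihilation b f = -(annihilation b f * G) := by
  have := congrArg Matrix.conjTranspose (h.parity_anticomm f)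
  rw [Matrix.conjTranspose_neg, Matrix.conjTranspose_mul, Matrix.conjTranspose_mul,
    h.parity_conjTranspose] at this
  rw [annihilation, this, neg_neg]

theorem IsGaussian.doubleCreation_anticomm (h : IsGaussian b Q s G N) (u k u' k' : H) :
    doubleCreation b G u k * doubleCreation b G u' k' +
      doubleCreation b G u' k' * doubleCreation b G u k = 0 := by
  have hG := h.parity_anticomm
  have hGc : ∀ f z, G * (creation b f * z) = -(creation b f * (G * z)) := fun f z => by
    rw [← mul_assoc, hG, neg_mul, mul_assoc]
  simp only [doubleCreation, mul_add, add_mul, bimul_mul, mul_assoc, mul_one, one_mul, hG, hGc,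
    h.parity_mul_self, mul_neg, neg_mul, neg_neg, bimul_neg_left]
  rw [creation_mul_comm_neg b u' u, creation_mul_comm_neg b k' k, bimul_neg_left, bimul_neg_right]
  abel

theorem IsGaussian.doubleCreation_anticomm_conjTranspose (h : IsGaussian b Q s G N)
    (u k u' k' : H) :
    (doubleCreation b G u k)ᴴ * doubleCreation b G u' k' +
      doubleCreation b G u' k' * (doubleCreation b G u k)ᴴ =
        (inner ℂ u u' + inner ℂ k k') • 1 := by
  have hG := h.parity_anticomm
  have hGc : ∀ f z, G * (creation b f * z) = -(creation b f * (G * z)) := fun f z => by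
    rw [← mul_assoc, hG, neg_mul, mul_assoc]
  have hGa := h.parity_anticomm_annihilation
  have hGac : ∀ f z, G * (annihilation b f * z) = -(annihilation b f * (G * z)) := fun f z => by
    rw [← mul_assoc, hGa, neg_mul, mul_assoc]
  have ha : (doubleCreation b G u k)ᴴ =
      bimul G (annihilation b u) + bimul (annihilation b k * G) 1 := by
    rw [doubleCreation, Matrix.conjTranspose_add, conjTranspose_bimul, conjTranspose_bimul,
      Matrix.conjTranspose_mul, h.parity_conjTranspose, Matrix.conjTranspose_one]
    rfl
  have h1 : annihilation b u * creation b u' = inner ℂ u u' • 1 - creation b u' * annihilation b u :=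
    eq_sub_of_add_eq (annihilation_creation_anticomm b u u')
  have h2 : annihilation b k * creation b k' = inner ℂ k k' • 1 - creation b k' * annihilation b k :=
    eq_sub_of_add_eq (annihilation_creation_anticomm b k k')
  rw [ha]
  simp only [doubleCreation, mul_add, add_mul, bimul_mul, mul_assoc, one_mul, mul_one, hGc, hG,
    h.parity_mul_self, mul_neg, neg_neg, bimul_neg_left, hGac, neg_mul]
  rw [h1, h2, sub_eq_add_neg, sub_eq_add_neg, bimul_add_left, bimul_add_right, bimul_neg_left,
    bimul_neg_right, bimul_smul_left, bimul_smul_right, bimul_one_one, add_smul]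
  abel

theorem IsGaussian.bimul_parity_anticomm (h : IsGaussian b Q s G N) (u k : H) :
    bimul G G * doubleCreation b G u k = -(doubleCreation b G u k * bimul G G) := by
  have hG := h.parity_anticomm
  have hGc : ∀ f z, G * (creation b f * z) = -(creation b f * (G * z)) := fun f z => by
    rw [← mul_assoc, hG, neg_mul, mul_assoc]
  simp only [doubleCreation, mul_add, add_mul, bimul_mul, mul_assoc, hG, hGc, mul_one, one_mul,
    mul_neg, neg_mul, bimul_neg_left, bimul_neg_right, neg_add_rev, h.parity_mul_self, neg_neg]
  abel

theorem IsGaussian.bimul_parity_mul_self (h : IsGaussian b Q s G N) :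
    bimul G G * bimul G G = 1 := by
  rw [bimul_mul, h.parity_mul_self, bimul_one_one]

theorem IsGaussian.conjTranspose_bimul_parity (h : IsGaussian b Q s G N) :
    (bimul G G)ᴴ = bimul G G := by
  rw [conjTranspose_bimul, h.parity_conjTranspose]

theorem IsGaussian.bimul_parity_mulVec (h : IsGaussian b Q s G N) :
    bimul G G *ᵥ Matrix.vec s = Matrix.vec s := by
  rw [bimul_mulVec_vec, h.parity_comm, mul_assoc, h.parity_mul_self, mul_one]

/-- The number operator on Hilbert-Schmidt operators. -/
def doubleNumber (N : FockMatrix ι) : Matrix (Finset ι × Finset ι) (Finset ι × Finset ι) ℂ :=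
  -- The commutator with `N`: right multiplication by `a*(k)` also raises it by one, and it kills
  -- `s`, which commutes with `N`.
  bimul 1 N + bimul (-N) 1

theorem IsGaussian.conjTranspose_doubleNumber (h : IsGaussian b Q s G N) :
    (doubleNumber N)ᴴ = doubleNumber N := by
  rw [doubleNumber, Matrix.conjTranspose_add, conjTranspose_bimul, conjTranspose_bimul,
    Matrix.conjTranspose_neg, h.number_conjTranspose, Matrix.conjTranspose_one]

theorem IsGaussian.doubleNumber_mulVec (h : IsGaussian b Q s G N) :
    doubleNumber N *ᵥ Matrix.vec s = 0 := by
  rw [doubleNumber, Matrix.add_mulVec, bimul_mulVec_vec, bimul_mulVec_vec, ← Matrix.vec_add]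
  simp [h.number_comm]

theorem IsGaussian.doubleNumber_mul (h : IsGaussian b Q s G N) (u k : H) :
    doubleNumber N * doubleCreation b G u k =
      doubleCreation b G u k * doubleNumber N + doubleCreation b G u k := by
  have h1 : G * creation b k * N = N * (G * creation b k) - G * creation b k := by
    rw [← mul_assoc, h.number_parity, mul_assoc G N, h.number_mul, mul_add, ← mul_assoc]; abel
  simp only [doubleCreation, doubleNumber, mul_add, add_mul, bimul_mul, mul_one, one_mul, mul_neg,
    neg_mul, bimul_neg_left, h.number_mul, bimul_add_right, h.number_parity, h1, sub_eq_add_neg,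
    bimul_add_left]
  abel

/-- In the vector `s` the modes `(√Q f, √(1-Q) f)` are filled. Their orthogonal complement `(√(1-Q)
f, -√Q f)` is empty, by `conjTranspose_doubleCreation_mulVec`. -/
theorem IsGaussian.doubleCreation_mulVec (h : IsGaussian b Q s G N) (f : H) :
    doubleCreation b G (CFC.sqrt Q f) (CFC.sqrt (1 - Q) f) *ᵥ Matrix.vec s = 0 := by
  rw [doubleCreation, Matrix.add_mulVec, bimul_mulVec_vec, bimul_mulVec_vec, ← Matrix.vec_add,
    one_mul, h.parity_anticomm, mul_neg, ← mul_assoc, h.mul_creation, add_neg_cancel,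
    Matrix.vec_zero]

theorem IsGaussian.conjTranspose_doubleCreation_mulVec (h : IsGaussian b Q s G N) (f : H) :
    (doubleCreation b G (CFC.sqrt (1 - Q) f) (-CFC.sqrt Q f))ᴴ *ᵥ Matrix.vec s = 0 := by
  have h1 : annihilation b (CFC.sqrt (1 - Q) f) * s = s * annihilation b (CFC.sqrt Q f) := by
    have := congrArg Matrix.conjTranspose (h.mul_creation f)
    rw [Matrix.conjTranspose_mul, Matrix.conjTranspose_mul, h.conjTranspose_eq] at this
    exact this
  have h2 : creation b (-CFC.sqrt Q f) = -creation b (CFC.sqrt Q f) :=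
    map_neg (creationₗ b) _
  rw [doubleCreation, Matrix.conjTranspose_add, conjTranspose_bimul, conjTranspose_bimul,
    Matrix.conjTranspose_mul, h.parity_conjTranspose, Matrix.conjTranspose_one, Matrix.add_mulVec,
    bimul_mulVec_vec, bimul_mulVec_vec, ← Matrix.vec_add, one_mul, h2, Matrix.conjTranspose_neg]
  change Matrix.vec (annihilation b _ * s * G + s * (-annihilation b _ * G)) = 0
  rw [h1, neg_mul, mul_neg, ← mul_assoc, add_neg_cancel, Matrix.vec_zero]

/-- The density matrix of the purified state. -/
def pureDensity (s : FockMatrix ι) : Matrix (Finset ι × Finset ι) (Finset ι × Finset ι) ℂ :=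
  Matrix.vecMulVec (Matrix.vec s) (star (Matrix.vec s))

omit [LinearOrder ι] in
theorem mul_pureDensity {X : Matrix (Finset ι × Finset ι) (Finset ι × Finset ι) ℂ} :
    X * pureDensity s = Matrix.vecMulVec (X *ᵥ Matrix.vec s) (star (Matrix.vec s)) :=
  Matrix.mul_vecMulVec _ _ _

omit [LinearOrder ι] in
theorem pureDensity_mul {X : Matrix (Finset ι × Finset ι) (Finset ι × Finset ι) ℂ} :
    pureDensity s * X = Matrix.vecMulVec (Matrix.vec s) (star (Xᴴ *ᵥ Matrix.vec s)) := by
  rw [pureDensity, Matrix.vecMulVec_mul, Matrix.star_mulVec, Matrix.conjTranspose_conjTranspose]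

theorem IsGaussian.trace_pureDensity (h : IsGaussian b Q s G N) : (pureDensity s).trace = 1 := by
  rw [pureDensity, Matrix.trace_vecMulVec, dotProduct_comm, Matrix.star_vec_dotProduct_vec,
    h.conjTranspose_eq, h.trace_mul_self]

theorem IsGaussian.parity_mul_pureDensity (h : IsGaussian b Q s G N) :
    pureDensity s * bimul G G = bimul G G * pureDensity s := by
  rw [mul_pureDensity, pureDensity_mul, h.conjTranspose_bimul_parity, h.bimul_parity_mulVec]

theorem IsGaussian.number_mul_pureDensity (h : IsGaussian b Q s G N) :
    doubleNumber N * pureDensity s = pureDensity s * doubleNumber N := by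
  rw [mul_pureDensity, pureDensity_mul, h.conjTranspose_doubleNumber, h.doubleNumber_mulVec]
  ext; simp [Matrix.vecMulVec_apply]

/-- Decompose `(u, k)` into its filled and its empty component; the filled one is the vector on the
right-hand side. The density times an empty creator is zero, and so is a filled creator times the
density. -/
theorem IsGaussian.pureDensity_mul_creation [FiniteDimensional ℂ H] (h : IsGaussian b Q s G N)
    (hQ : IsSymbol Q) (u k : H) :
    pureDensity s * doubleCreation b G u k =
      pureDensity s * doubleCreation b G (Q u + sqrtVar Q k) (sqrtVar Q u + (1 - Q) k) +
        doubleCreation b G (Q u + sqrtVar Q k) (sqrtVar Q u + (1 - Q) k) * pureDensity s := by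
  have hQ' : 0 ≤ 1 - Q := sub_nonneg.2 hQ.2
  set f := CFC.sqrt Q u + CFC.sqrt (1 - Q) k with hf
  set g := CFC.sqrt (1 - Q) u - CFC.sqrt Q k with hg
  have h1 : Q u + sqrtVar Q k = CFC.sqrt Q f := by
    rw [hf, map_add, sqrt_apply_sqrt_apply hQ.1, (hQ.sqrtVar_apply k).1]
  have h2 : sqrtVar Q u + (1 - Q) k = CFC.sqrt (1 - Q) f := by
    rw [hf, map_add, sqrt_apply_sqrt_apply hQ', (hQ.sqrtVar_apply u).2]
  have h3 : doubleCreation b G u k = doubleCreation b G (CFC.sqrt Q f) (CFC.sqrt (1 - Q) f) +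
      doubleCreation b G (CFC.sqrt (1 - Q) g) (-CFC.sqrt Q g) := by
    rw [← doubleCreation_add]
    congr 1
    · rw [← h1, hg, map_sub, sqrt_apply_sqrt_apply hQ', (hQ.sqrtVar_apply k).2]
      simp
    · rw [← h2, hg, map_sub, sqrt_apply_sqrt_apply hQ.1, (hQ.sqrtVar_apply u).1]
      simp
      abel
  rw [h1, h2, mul_pureDensity, h.doubleCreation_mulVec, h3, mul_add,
    pureDensity_mul (X := doubleCreation b G (CFC.sqrt (1 - Q) g) (-CFC.sqrt Q g)),
    h.conjTranspose_doubleCreation_mulVec]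
  congr 1
  ext; simp [Matrix.vecMulVec_apply]

end Double

/-! ### The dilation of a quasi-free map -/

section Triple

variable {H : Type*} [NormedAddCommGroup H] [InnerProductSpace ℂ H] [CompleteSpace H]
variable {ι : Type*} [Fintype ι] [LinearOrder ι] {b : OrthonormalBasis ι ℂ H} {Q W : H →L[ℂ] H}
  {s G N r G' N' : FockMatrix ι}

/-- The creation operators over `H ⊕ H ⊕ H` on the tensor product of the Hilbert-Schmidt operators
on Fock space with Fock space. -/
def tripleCreation (b : OrthonormalBasis ι ℂ H) (G : FockMatrix ι) (u k f : H) :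
    Matrix ((Finset ι × Finset ι) × Finset ι) ((Finset ι × Finset ι) × Finset ι) ℂ :=
  -- `bimul G G` is the parity of the doubled system, and it makes the last factor anticommute with
  -- the first two.
  doubleCreation b G u k ⊗ₖ 1 + bimul G G ⊗ₖ creation b f

omit [Fintype ι] [LinearOrder ι] in
theorem neg_kronecker {m n : Type*} (x : Matrix m m ℂ) (y : Matrix n n ℂ) :
    (-x) ⊗ₖ y = -(x ⊗ₖ y) := by
  ext; simp

omit [Fintype ι] [LinearOrder ι] in
theorem kronecker_neg {m n : Type*} (x : Matrix m m ℂ) (y : Matrix n n ℂ) :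
    x ⊗ₖ (-y) = -(x ⊗ₖ y) := by
  ext; simp

theorem IsGaussian.tripleCreation_anticomm (h : IsGaussian b Q s G N) (u k f u' k' f' : H) :
    tripleCreation b G u k f * tripleCreation b G u' k' f' +
      tripleCreation b G u' k' f' * tripleCreation b G u k f = 0 := by
  have h1 := eq_neg_of_add_eq_zero_left (h.doubleCreation_anticomm u k u' k')
  simp only [tripleCreation, mul_add, add_mul, ← Matrix.mul_kronecker_mul, mul_one, one_mul,
    h.bimul_parity_anticomm, h.bimul_parity_mul_self, h1, creation_mul_comm_neg b f f',
    neg_kronecker, kronecker_neg]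
  abel

theorem conjTranspose_tripleCreation (h : IsGaussian b Q s G N) (u k f : H) :
    (tripleCreation b G u k f)ᴴ =
      (doubleCreation b G u k)ᴴ ⊗ₖ 1 + bimul G G ⊗ₖ annihilation b f := by
  rw [tripleCreation, Matrix.conjTranspose_add, Matrix.conjTranspose_kronecker,
    Matrix.conjTranspose_kronecker, h.conjTranspose_bimul_parity, Matrix.conjTranspose_one]
  rfl

theorem IsGaussian.bimul_parity_anticomm_conjTranspose (h : IsGaussian b Q s G N) (u k : H) :
    bimul G G * (doubleCreation b G u k)ᴴ = -((doubleCreation b G u k)ᴴ * bimul G G) := by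
  have := congrArg Matrix.conjTranspose (h.bimul_parity_anticomm u k)
  rw [Matrix.conjTranspose_neg, Matrix.conjTranspose_mul, Matrix.conjTranspose_mul,
    h.conjTranspose_bimul_parity] at this
  rw [this, neg_neg]

theorem IsGaussian.tripleCreation_anticomm_conjTranspose (h : IsGaussian b Q s G N)
    (u k f u' k' f' : H) :
    (tripleCreation b G u k f)ᴴ * tripleCreation b G u' k' f' +
      tripleCreation b G u' k' f' * (tripleCreation b G u k f)ᴴ =
        (inner ℂ u u' + inner ℂ k k' + inner ℂ f f') • 1 := by
  have h1 := eq_sub_of_add_eq (h.doubleCreation_anticomm_conjTranspose u k u' k')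
  have h2 := eq_sub_of_add_eq (annihilation_creation_anticomm b f f')
  rw [conjTranspose_tripleCreation h]
  simp only [tripleCreation, mul_add, add_mul, ← Matrix.mul_kronecker_mul, mul_one, one_mul,
    h.bimul_parity_anticomm, h.bimul_parity_anticomm_conjTranspose, h.bimul_parity_mul_self, h1, h2,
    neg_kronecker, kronecker_neg, sub_eq_add_neg, Matrix.add_kronecker, Matrix.kronecker_add,
    Matrix.smul_kronecker, Matrix.kronecker_smul, Matrix.one_kronecker_one, add_smul]
  abel

/-- The exchange relations of the two tensor factors add up, because the parity `bimul G G` commutes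
with the pure density. The symbol is the projection of the doubled system plus `W`. -/
theorem IsGaussian.pureDensity_mul_tripleCreation [FiniteDimensional ℂ H]
    (h : IsGaussian b Q s G N) (hW : IsGaussian b W r G' N') (hQ : IsSymbol Q) (hWs : IsSymbol W)
    (u k f : H) :
    (pureDensity s ⊗ₖ (r * r)) * tripleCreation b G u k f =
      (pureDensity s ⊗ₖ (r * r)) *
          tripleCreation b G (Q u + sqrtVar Q k) (sqrtVar Q u + (1 - Q) k) (W f) +
        tripleCreation b G (Q u + sqrtVar Q k) (sqrtVar Q u + (1 - Q) k) (W f) *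
          (pureDensity s ⊗ₖ (r * r)) := by
  simp only [tripleCreation, mul_add, add_mul, ← Matrix.mul_kronecker_mul, mul_one, one_mul]
  rw [hW.mul_self_mul_creation hWs, Matrix.kronecker_add, h.pureDensity_mul_creation hQ,
    Matrix.add_kronecker, h.parity_mul_pureDensity]
  abel

theorem IsGaussian.trace_triple (h : IsGaussian b Q s G N) (hW : IsGaussian b W r G' N') :
    (pureDensity s ⊗ₖ (r * r)).trace = 1 := by
  rw [Matrix.trace_kronecker, h.trace_pureDensity, hW.trace_mul_self, one_mul]

/-- The number operator on the triple tensor product. -/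
def tripleNumber (N N' : FockMatrix ι) :
    Matrix ((Finset ι × Finset ι) × Finset ι) ((Finset ι × Finset ι) × Finset ι) ℂ :=
  doubleNumber N ⊗ₖ 1 + 1 ⊗ₖ N'

theorem IsGaussian.doubleNumber_mul_parity (h : IsGaussian b Q s G N) :
    doubleNumber N * bimul G G = bimul G G * doubleNumber N := by
  simp only [doubleNumber, add_mul, mul_add, bimul_mul, mul_one, one_mul, mul_neg, neg_mul,
    h.number_parity]

theorem IsGaussian.tripleNumber_mul (h : IsGaussian b Q s G N) (hW : IsGaussian b W r G' N')
    (u k f : H) :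
    tripleNumber N N' * tripleCreation b G u k f =
      tripleCreation b G u k f * tripleNumber N N' + tripleCreation b G u k f := by
  simp only [tripleNumber, tripleCreation, mul_add, add_mul, ← Matrix.mul_kronecker_mul, mul_one,
    one_mul, h.doubleNumber_mul, h.doubleNumber_mul_parity, hW.number_mul, Matrix.add_kronecker,
    Matrix.kronecker_add]
  abel

theorem IsGaussian.conjTranspose_tripleNumber (h : IsGaussian b Q s G N)
    (hW : IsGaussian b W r G' N') : (tripleNumber N N')ᴴ = tripleNumber N N' := by
  simp only [tripleNumber, Matrix.conjTranspose_add, Matrix.conjTranspose_kronecker,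
    h.conjTranspose_doubleNumber, hW.number_conjTranspose, Matrix.conjTranspose_one]

theorem IsGaussian.tripleNumber_mul_density (h : IsGaussian b Q s G N)
    (hW : IsGaussian b W r G' N') :
    tripleNumber N N' * (pureDensity s ⊗ₖ (r * r)) =
      (pureDensity s ⊗ₖ (r * r)) * tripleNumber N N' := by
  have : N' * (r * r) = r * r * N' := by
    rw [← mul_assoc, hW.number_comm, mul_assoc, hW.number_comm, mul_assoc]
  simp only [tripleNumber, mul_add, add_mul, ← Matrix.mul_kronecker_mul, mul_one, one_mul,
    h.number_mul_pureDensity, this]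

end Triple

/-! ### Normal-ordered words -/

section Words

variable {H : Type*} [NormedAddCommGroup H] [InnerProductSpace ℂ H]
variable {ι : Type*} [Fintype ι] [LinearOrder ι] (b : OrthonormalBasis ι ℂ H)

/-- A letter: `a*(f)` for `(false, f)` and `a(f)` for `(true, f)`. -/
def letter (c : Bool × H) : FockMatrix ι :=
  if c.1 then annihilation b c.2 else creation b c.2

/-- A word is normal-ordered if all creation operators are to the left of all annihilation
operators. -/
def IsNormalWord (w : List (Bool × H)) : Prop := w.Pairwise fun c d => c.1 ≤ d.1

omit [NormedAddCommGroup H] [InnerProductSpace ℂ H] in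
theorem IsNormalWord.exists_index {w : List (Bool × H)} (hw : IsNormalWord w) :
    ∃ k : ℕ, ∀ i : Fin w.length, (i : ℕ) < k ↔ (w.get i).1 = false := by
  induction w with
  | nil => exact ⟨0, fun i => i.elim0⟩
  | cons c w ih =>
    have hp := List.pairwise_cons.1 hw
    obtain ⟨k, hk⟩ := ih hp.2
    rcases hc : c.1 with _ | _
    · refine ⟨k + 1, fun i => ?_⟩
      refine Fin.cases ?_ (fun j => ?_) i
      · simp [hc]
      · simpa using hk j
    · refine ⟨0, fun i => ?_⟩
      refine Fin.cases ?_ (fun j => ?_) i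
      · simp [hc]
      · have := hp.1 _ (List.get_mem w j)
        rw [hc] at this
        have h2 : (w.get j).1 = true := by
          rcases h3 : (w.get j).1 with _ | _
          · rw [h3] at this; exact absurd this (by decide)
          · rfl
        simpa using h2

/-- The value of a quasi-free map on a normal-ordered word. -/
theorem IsQuasiFreeMap.apply_word [CompleteSpace H] {V W : H →L[ℂ] H}
    {Λ : FockMatrix ι → FockMatrix ι} (hΛ : IsQuasiFreeMap b V W Λ)
    {w : List (Bool × H)} (hw : IsNormalWord w) {ωW : FockMatrix ι →ₗ[ℂ] ℂ}
    (hωW : IsQuasiFreeState b W ωW) :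
    Λ (w.map (letter b)).prod = ∑ S : Finset (Fin w.length),
      (shuffleSign S * ωW (orderedProd Sᶜ fun i => letter b (w.get i))) •
        orderedProd S fun i => letter b ((w.get i).1, V (w.get i).2) := by
  obtain ⟨-, -, ω', hω', h⟩ := hΛ
  obtain rfl := hωW.unique hω'
  obtain ⟨k, hk⟩ := hw.exists_index
  have h1 := h k w.length fun i => (w.get i).2
  have h2 : (ladder b k fun i => (w.get i).2) = fun i => letter b (w.get i) := by
    funext i
    rw [ladder, letter]
    by_cases hi : (i : ℕ) < k
    · rw [if_pos hi, if_neg (by rw [(hk i).1 hi]; decide)]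
    · rw [if_neg hi, if_pos (by simpa using mt (hk i).2 hi)]
  have h3 : (ladder b k fun i => V (w.get i).2) =
      fun i => letter b ((w.get i).1, V (w.get i).2) := by
    funext i
    rw [ladder, letter]
    by_cases hi : (i : ℕ) < k
    · rw [if_pos hi, if_neg (by rw [(hk i).1 hi]; decide)]
    · rw [if_neg hi, if_pos (by simpa using mt (hk i).2 hi)]
  rw [h2, h3] at h1
  rw [← h1]
  congr 1
  have h4 : (w.map (letter b)) = (List.finRange w.length).map fun i => letter b (w.get i) := by
    rw [← List.ofFn_eq_map]
    conv_lhs => rw [← List.ofFn_get w, List.map_ofFn]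
    rfl
  rw [h4, orderedProd]
  simp

end Words

/-! ### Quasi-free maps as restrictions of a product state -/

section Dilation

variable {H : Type*} [NormedAddCommGroup H] [InnerProductSpace ℂ H] [CompleteSpace H]
variable {ι : Type*} [Fintype ι] [LinearOrder ι] {b : OrthonormalBasis ι ℂ H}
  {Q V W : H →L[ℂ] H} {s G N r G' N' : FockMatrix ι}

/-- Left multiplication on the first tensor factor. -/
def leftHom (ι : Type*) [Fintype ι] [DecidableEq ι] : FockMatrix ι →*
    Matrix ((Finset ι × Finset ι) × Finset ι) ((Finset ι × Finset ι) × Finset ι) ℂ where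
  toFun y := bimul 1 y ⊗ₖ 1
  map_one' := by rw [bimul_one_one, Matrix.one_kronecker_one]
  map_mul' y z := by rw [← Matrix.mul_kronecker_mul, bimul_mul, mul_one]

/-- Multiplication on the last tensor factor. -/
def lastHom (ι : Type*) [Fintype ι] [DecidableEq ι] : FockMatrix ι →*
    Matrix ((Finset ι × Finset ι) × Finset ι) ((Finset ι × Finset ι) × Finset ι) ℂ where
  toFun y := 1 ⊗ₖ y
  map_one' := Matrix.one_kronecker_one
  map_mul' y z := by rw [← Matrix.mul_kronecker_mul, mul_one]

theorem leftHom_apply (y : FockMatrix ι) : leftHom ι y = bimul 1 y ⊗ₖ 1 := rfl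

theorem lastHom_apply (y : FockMatrix ι) : lastHom ι y = 1 ⊗ₖ y := rfl

theorem map_orderedProd {A B F : Type*} [Monoid A] [Monoid B] [FunLike F A B]
    [MonoidHomClass F A B] (T : F) {n : ℕ} (S : Finset (Fin n)) (y : Fin n → A) :
    orderedProd S (fun i => T (y i)) = T (orderedProd S y) := by
  rw [orderedProd, orderedProd, map_list_prod, List.map_map]
  rfl

/-- The dilation of a letter under the quasi-free map determined by `V`. -/
def dilatedLetter (b : OrthonormalBasis ι ℂ H) (V : H →L[ℂ] H) (G : FockMatrix ι)
    (c : Bool × H) :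
    Matrix ((Finset ι × Finset ι) × Finset ι) ((Finset ι × Finset ι) × Finset ι) ℂ :=
  leftHom ι (letter b (c.1, V c.2)) + leftHom ι G * lastHom ι (letter b c)

theorem IsGaussian.parity_anticomm_letter (h : IsGaussian b Q s G N) (c : Bool × H) :
    G * letter b c = -(letter b c * G) := by
  rw [letter]
  split_ifs
  · exact h.parity_anticomm_annihilation _
  · exact h.parity_anticomm _

/-- The parity commutes with `s` and anticommutes with an odd product, so the value equals its own
negative. -/
theorem IsGaussian.trace_odd (h : IsGaussian b Q s G N) {n : ℕ} (c : Fin n → Bool × H)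
    (S : Finset (Fin n)) (hS : Odd ((List.finRange n).filter (· ∈ S)).length) :
    traceForm (s * s) (orderedProd S fun i => letter b (c i)) = 0 := by
  set y := orderedProd S fun i => letter b (c i) with hy
  have h1 : G * y = -(y * G) := by
    rw [hy, orderedProd, mul_list_prod_of_anticomm G _ fun i => h.parity_anticomm_letter (c i),
      hS.neg_one_pow, neg_one_smul]
  have h2 : traceForm (s * s) y = -traceForm (s * s) y := by
    simp only [traceForm_apply]
    conv_lhs => rw [← one_mul y, ← h.parity_mul_self, mul_assoc G G, h1]
    rw [mul_neg, mul_neg, Matrix.trace_neg, ← mul_assoc, ← mul_assoc, Matrix.trace_mul_comm,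
      ← mul_assoc, ← mul_assoc, ← mul_assoc, h.parity_comm, mul_assoc s G s, h.parity_comm,
      ← mul_assoc, mul_assoc (s * s) G G, h.parity_mul_self, mul_one]
  exact self_eq_neg.1 h2

variable {n : ℕ}

/-- The matrix with columns `x_j s`. -/
def krausColumns (x : Fin n → FockMatrix ι) (s : FockMatrix ι) :
    Matrix (Finset ι × Finset ι) (Fin n) ℂ :=
  Matrix.of fun p j => Matrix.vec (x j * s) p

/-- Moving the `x_j` from the vectors `x_j s` to the observable affects only the left multiplication
by `y`, since right multiplications commute with it. -/
theorem traceForm_krausColumns (x : Fin n → FockMatrix ι) (s : FockMatrix ι) (z y : FockMatrix ι) :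
    traceForm (krausColumns x s * (krausColumns x s)ᴴ) (bimul z y) =
      traceForm (pureDensity s) (bimul z (partitionMap x y)) := by
  have h1 : krausColumns x s * (krausColumns x s)ᴴ =
      ∑ j, Matrix.vecMulVec (Matrix.vec (x j * s)) (star (Matrix.vec (x j * s))) := by
    ext p q
    simp [krausColumns, Matrix.mul_apply, Matrix.sum_apply, Matrix.vecMulVec_apply]
  rw [h1, traceForm_apply, traceForm_apply, pureDensity, trace_vecMulVec_mul,
    star_vec_dotProduct_bimul, Finset.sum_mul, Matrix.trace_sum, partitionMap, Finset.sum_mul,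
    Finset.sum_mul, Finset.mul_sum, Matrix.trace_sum]
  refine Finset.sum_congr rfl fun j _ => ?_
  rw [trace_vecMulVec_mul, star_vec_dotProduct_bimul, Matrix.conjTranspose_mul]
  simp only [mul_assoc]

/-- `bimul` as a linear map of the left factor. -/
def bimulₗ {m : Type*} (z : Matrix m m ℂ) : Matrix m m ℂ →ₗ[ℂ] Matrix (m × m) (m × m) ℂ where
  toFun := bimul z
  map_add' := bimul_add_right z
  map_smul' r y := bimul_smul_right r z y

/-- Expanding the product of dilated letters gives the sum over `S` that defines the quasi-free map,
up to a power of `G`. That power is 1 if the complement of `S` is even; otherwise the value in `ω_W`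
is zero on both sides. -/
theorem IsGaussian.dilation_word (h : IsGaussian b Q s G N) (hW : IsGaussian b W r G' N')
    (hωW : IsQuasiFreeState b W (traceForm (r * r))) (x : Fin n → FockMatrix ι)
    (hΛ : IsQuasiFreeMap b V W (partitionMap x)) {w : List (Bool × H)} (hw : IsNormalWord w)
    (β : FockMatrix ι) :
    traceForm (pureDensity s ⊗ₖ (r * r)) ((w.map (dilatedLetter b V G)).prod * bimul β 1 ⊗ₖ 1) =
      traceForm (krausColumns x s * (krausColumns x s)ᴴ) (bimul β (w.map (letter b)).prod) := by
  have hw' : w.map (dilatedLetter b V G) = (List.finRange w.length).map fun i =>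
      leftHom ι (letter b ((w.get i).1, V (w.get i).2)) +
        leftHom ι G * lastHom ι (letter b (w.get i)) := by
    rw [← List.ofFn_eq_map]
    conv_lhs => rw [← List.ofFn_get w, List.map_ofFn]
    rfl
  rw [traceForm_krausColumns, hΛ.apply_word b hw hωW, hw', finRange_prod_add_mul]
  · rw [Finset.sum_mul, map_sum]
    change _ = traceForm (pureDensity s) (bimulₗ β _)
    rw [map_sum, map_sum]
    refine Finset.sum_congr rfl fun S _ => ?_
    rw [map_orderedProd (leftHom ι), map_orderedProd (lastHom ι), ← map_pow, ← map_mul, map_smul,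
      map_smul, smul_mul_assoc, map_smul, smul_eq_mul, smul_eq_mul]
    conv_rhs => rw [mul_assoc]
    congr 1
    rw [leftHom_apply, lastHom_apply, ← Matrix.mul_kronecker_mul, ← Matrix.mul_kronecker_mul,
      mul_one, one_mul, mul_one, bimul_mul, mul_one, mul_one, traceForm_apply,
      ← Matrix.mul_kronecker_mul, Matrix.trace_kronecker]
    rcases Nat.even_or_odd ((List.finRange w.length).filter (· ∈ Sᶜ)).length with he | ho
    · obtain ⟨k, hk⟩ := he
      rw [hk, ← two_mul, pow_mul, pow_two, h.parity_mul_self, one_pow, mul_one, mul_comm]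
      rfl
    · rw [hW.trace_odd _ _ ho, zero_mul, ← traceForm_apply (r * r), hW.trace_odd _ _ ho, mul_zero]
  · intro i
    rw [← map_mul, h.parity_anticomm_letter, leftHom_apply, bimul_neg_right, neg_kronecker,
      ← leftHom_apply, map_mul]
  · intro i
    rw [leftHom_apply, lastHom_apply, ← Matrix.mul_kronecker_mul, ← Matrix.mul_kronecker_mul,
      mul_one, one_mul, mul_one, one_mul]
  · intro i j
    rw [leftHom_apply, lastHom_apply, ← Matrix.mul_kronecker_mul, ← Matrix.mul_kronecker_mul,
      mul_one, one_mul, mul_one, one_mul]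

/-- A creation or annihilation operator over `H ⊕ H`. -/
def doubleLetter (b : OrthonormalBasis ι ℂ H) (G : FockMatrix ι) (c : Bool × H × H) :
    Matrix (Finset ι × Finset ι) (Finset ι × Finset ι) ℂ :=
  if c.1 then (doubleCreation b G c.2.1 c.2.2)ᴴ else doubleCreation b G c.2.1 c.2.2

/-- The dilation of a creation or annihilation operator over `H ⊕ H`. -/
def tripleLetter (b : OrthonormalBasis ι ℂ H) (V : H →L[ℂ] H) (G : FockMatrix ι)
    (c : Bool × H × H) :
    Matrix ((Finset ι × Finset ι) × Finset ι) ((Finset ι × Finset ι) × Finset ι) ℂ :=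
  if c.1 then (tripleCreation b G (V c.2.1) c.2.2 c.2.1)ᴴ
  else tripleCreation b G (V c.2.1) c.2.2 c.2.1

/-- The factor of a letter that acts by right multiplication. -/
def rightLetter (b : OrthonormalBasis ι ℂ H) (G : FockMatrix ι) (c : Bool × H × H) :
    FockMatrix ι :=
  if c.1 then annihilation b c.2.2 * G else G * creation b c.2.2

theorem IsGaussian.conjTranspose_doubleCreation (h : IsGaussian b Q s G N) (u k : H) :
    (doubleCreation b G u k)ᴴ = bimul G (annihilation b u) + bimul (annihilation b k * G) 1 := by
  rw [doubleCreation, Matrix.conjTranspose_add, conjTranspose_bimul, conjTranspose_bimul,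
    Matrix.conjTranspose_mul, h.parity_conjTranspose, Matrix.conjTranspose_one]
  rfl

theorem IsGaussian.doubleLetter_eq (h : IsGaussian b Q s G N) (c : Bool × H × H) :
    doubleLetter b G c = bimul G (letter b (c.1, c.2.1)) + bimul (rightLetter b G c) 1 := by
  obtain ⟨_ | _, f, k⟩ := c
  · rfl
  · exact h.conjTranspose_doubleCreation f k

theorem IsGaussian.tripleLetter_eq (h : IsGaussian b Q s G N) (c : Bool × H × H) :
    tripleLetter b V G c = dilatedLetter b V G (c.1, c.2.1) * bimul G 1 ⊗ₖ 1 +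
      bimul (rightLetter b G c) 1 ⊗ₖ 1 := by
  simp only [dilatedLetter, leftHom_apply, lastHom_apply, add_mul, ← Matrix.mul_kronecker_mul,
    mul_one, one_mul, bimul_mul]
  obtain ⟨_ | _, f, k⟩ := c
  · simp only [tripleLetter, tripleCreation, doubleCreation, letter, rightLetter,
      Matrix.add_kronecker]
    simp only [Bool.false_eq_true, if_false]
    abel
  · simp only [tripleLetter, if_true, conjTranspose_tripleCreation h,
      h.conjTranspose_doubleCreation, letter, rightLetter, Matrix.add_kronecker]
    abel

/-- A letter over `H ⊕ H` is a left plus a right multiplication. The induction takes letters off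
`l`, appends the left part to `w` and absorbs the right part in `β`, which commutes with dilated
letters; an empty `l` leaves `dilation_word`. -/
theorem IsGaussian.dilation_double_word (h : IsGaussian b Q s G N)
    (hW : IsGaussian b W r G' N') (hωW : IsQuasiFreeState b W (traceForm (r * r)))
    (x : Fin n → FockMatrix ι) (hΛ : IsQuasiFreeMap b V W (partitionMap x))
    (l : List (Bool × H × H)) (w : List (Bool × H)) (β : FockMatrix ι)
    (hw : IsNormalWord (w ++ l.map fun c => (c.1, c.2.1))) :
    traceForm (pureDensity s ⊗ₖ (r * r)) ((w.map (dilatedLetter b V G)).prod * bimul β 1 ⊗ₖ 1 *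
        (l.map (tripleLetter b V G)).prod) =
      traceForm (krausColumns x s * (krausColumns x s)ᴴ)
        (bimul β (w.map (letter b)).prod * (l.map (doubleLetter b G)).prod) := by
  induction l generalizing w β with
  | nil =>
    have hw' : IsNormalWord w := by simpa using hw
    simpa using h.dilation_word hW hωW x hΛ hw' β
  | cons c l ih =>
    have hw1 : IsNormalWord ((w ++ [(c.1, c.2.1)]) ++ l.map fun c => (c.1, c.2.1)) := by
      simpa using hw
    have hw2 : IsNormalWord (w ++ l.map fun c => (c.1, c.2.1)) :=
      List.Pairwise.sublist (List.Sublist.append (List.Sublist.refl w)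
        (List.sublist_cons_self _ _)) hw
    have ih1 := ih (w ++ [(c.1, c.2.1)]) (G * β) hw1
    have ih2 := ih w (rightLetter b G c * β) hw2
    have hcomm : ∀ c', bimul β 1 ⊗ₖ 1 * dilatedLetter b V G c' =
        dilatedLetter b V G c' * bimul β 1 ⊗ₖ 1 := by
      intro c'
      simp only [dilatedLetter, leftHom_apply, lastHom_apply, mul_add, add_mul,
        ← Matrix.mul_kronecker_mul, mul_one, one_mul, bimul_mul]
    have e1 : bimul β 1 ⊗ₖ 1 * tripleLetter b V G c =
        dilatedLetter b V G (c.1, c.2.1) * bimul (G * β) 1 ⊗ₖ 1 +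
          bimul (rightLetter b G c * β) 1 ⊗ₖ (1 : FockMatrix ι) := by
      rw [h.tripleLetter_eq, mul_add, ← mul_assoc, hcomm, mul_assoc]
      simp only [← Matrix.mul_kronecker_mul, mul_one, bimul_mul]
    have e2 : ∀ y, bimul β y * doubleLetter b G c =
        bimul (G * β) (y * letter b (c.1, c.2.1)) + bimul (rightLetter b G c * β) y := by
      intro y
      rw [h.doubleLetter_eq, mul_add, bimul_mul, bimul_mul, mul_one]
    rw [List.map_cons, List.map_cons, List.prod_cons, List.prod_cons, ← mul_assoc, ← mul_assoc, e2,
      mul_assoc (List.prod _), e1, mul_add, add_mul, add_mul, map_add, map_add, ← ih2]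
    rw [List.map_append, List.map_append, List.prod_append, List.prod_append] at ih1
    simp only [List.map_cons, List.map_nil, List.prod_cons, List.prod_nil, mul_one] at ih1
    rw [← ih1, ← mul_assoc]

end Dilation

/-! ### Entropy from a diagonal two-point function -/

section RootWick

variable {κ m : Type*} [Fintype m] [DecidableEq m] [DecidableEq κ] {a : κ → Matrix m m ℂ}
  {l : κ → ℝ} {s G N : Matrix m m ℂ}

omit [DecidableEq κ] in
theorem IsGaussianRoot.mul_self_mul (h : IsGaussianRoot a l s G N) (hl0 : ∀ i, 0 ≤ l i)
    (hl1 : ∀ i, l i ≤ 1) (i : κ) :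
    s * s * a i = s * s * ((l i : ℂ) • a i) + ((l i : ℂ) • a i) * (s * s) := by
  have h1 : ((√(1 - l i) : ℝ) : ℂ) * (√(1 - l i) : ℝ) = 1 - (l i : ℝ) := by
    rw [← Complex.ofReal_mul, Real.mul_self_sqrt (sub_nonneg.2 (hl1 i))]; simp
  have h2 : ((√(l i) : ℝ) : ℂ) * (√(l i) : ℝ) = (l i : ℝ) := by
    rw [← Complex.ofReal_mul, Real.mul_self_sqrt (hl0 i)]
  have h3 : (1 - (l i : ℂ)) • (s * s * a i) = (l i : ℂ) • (a i * (s * s)) := by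
    rw [← h1, ← h2, mul_smul, mul_smul, mul_assoc, ← mul_smul_comm, h.mul_creation, mul_smul_comm,
      ← mul_assoc, smul_comm, ← smul_mul_assoc, h.mul_creation, smul_mul_assoc, mul_assoc]
  rw [mul_smul_comm, smul_mul_assoc, ← h3, sub_smul, one_smul]
  abel

theorem IsGaussianRoot.wick_det (h : IsGaussianRoot a l s G N) (ha : IsCAR a)
    (hl0 : ∀ i, 0 ≤ l i) (hl1 : ∀ i, l i ≤ 1) (k : ℕ) (f g : Fin k → κ) :
    traceForm (s * s) (wickMonomial a (fun i => (a i)ᴴ) f g) =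
      Matrix.det (Matrix.of fun i j => if g i = f j then (l (f j) : ℂ) else 0) := by
  refine traceForm_wick_det a (fun i => (l i : ℂ) • a i)
    (fun g f => if g = f then (l f : ℂ) else 0) (fun i j => ?_) (fun i j => ?_)
    (h.mul_self_mul hl0 hl1) h.trace_mul_self k f g
  · rw [smul_mul_assoc, mul_smul_comm, ← smul_add, ha.anticomm, smul_zero]
  · rw [smul_mul_assoc, mul_smul_comm, ← smul_add, ha.anticomm_conjTranspose]
    split_ifs <;> simp

omit [DecidableEq κ] in
theorem IsGaussianRoot.wick_zero (h : IsGaussianRoot a l s G N) {k k' : ℕ} (hk : k ≠ k')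
    (f : Fin k → κ) (g : Fin k' → κ) :
    traceForm (s * s) (wickMonomial a (fun i => (a i)ᴴ) f g) = 0 := by
  refine traceForm_wick_zero a h.number_conjTranspose h.number_mul ?_ hk f g
  rw [← mul_assoc, h.number_comm, mul_assoc, h.number_comm, mul_assoc]

end RootWick

/-- The entropy of a density matrix that is given by determinants on normal-ordered monomials in
modes that diagonalise its two-point function. -/
theorem IsCAR.vonNeumannEntropy_eq {κ m : Type*} [Fintype m] [DecidableEq m] [Fintype κ]
    [LinearOrder κ] {a : κ → Matrix m m ℂ} (ha : IsCAR a)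
    (hcard : Fintype.card m = 2 ^ Fintype.card κ) {l : κ → ℝ} (hl0 : ∀ i, 0 ≤ l i)
    (hl1 : ∀ i, l i ≤ 1) {D : Matrix m m ℂ}
    (hdet : ∀ (k : ℕ) (f g : Fin k → κ), traceForm D (wickMonomial a (fun i => (a i)ᴴ) f g) =
      Matrix.det (Matrix.of fun i j => if g i = f j then (l (f j) : ℂ) else 0))
    (hzero : ∀ (k k' : ℕ) (f : Fin k → κ) (g : Fin k' → κ), k ≠ k' →
      traceForm D (wickMonomial a (fun i => (a i)ᴴ) f g) = 0) :
    vonNeumannEntropy D = ∑ i, (Real.negMulLog (l i) + Real.negMulLog (1 - l i)) := by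
  obtain ⟨s, G, N, h, hS⟩ := ha.exists_isGaussianRoot hcard hl0 hl1
  -- The values on normal-ordered monomials determine the functional, so `D` is the product density.
  have key : traceForm D = traceForm (s * s) := by
    refine ha.ext hcard fun k k' f g => ?_
    by_cases hk : k = k'
    · subst hk
      rw [hdet, h.wick_det ha hl0 hl1]
    · rw [hzero _ _ _ _ hk, h.wick_zero hk]
  rw [← densityMatrix_traceForm D, key, densityMatrix_traceForm, hS]

/-! ### The correlation matrix -/

section Correlation

variable {ι : Type*} [Fintype ι] [LinearOrder ι] {n : ℕ}

/-- The correlation matrix is the transposed Gram matrix of the columns; passing to the opposite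
product moves the entropy to a density on Hilbert-Schmidt space. -/
theorem partitionEntropy_traceForm {s : FockMatrix ι} (hs : sᴴ = s) (x : Fin n → FockMatrix ι) :
    partitionEntropy (traceForm (s * s)) x =
      vonNeumannEntropy (krausColumns x s * (krausColumns x s)ᴴ) := by
  have h1 : correlationMatrix (traceForm (s * s)) x =
      ((krausColumns x s)ᴴ * krausColumns x s)ᵀ := by
    ext i j
    have h2 : ((krausColumns x s)ᴴ * krausColumns x s) j i =
        star (Matrix.vec (x j * s)) ⬝ᵥ Matrix.vec (x i * s) := by
      simp [krausColumns, Matrix.mul_apply, dotProduct]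
    rw [Matrix.transpose_apply, h2, Matrix.star_vec_dotProduct_vec, Matrix.conjTranspose_mul, hs,
      correlationMatrix, Matrix.of_apply, traceForm_apply, Matrix.trace_mul_comm, ← mul_assoc,
      Matrix.trace_mul_comm]
    simp only [mul_assoc]
  rw [partitionEntropy, h1,
    vonNeumannEntropy_transpose (Matrix.isHermitian_conjTranspose_mul_self _),
    vonNeumannEntropy_conjTranspose_mul_self]

variable {H : Type*} [NormedAddCommGroup H] [InnerProductSpace ℂ H] [CompleteSpace H]
variable {b : OrthonormalBasis ι ℂ H} {Q V W : H →L[ℂ] H} {s G N r G' N' : FockMatrix ι}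

theorem IsGaussian.krausColumns_wickMonomial (h : IsGaussian b Q s G N)
    (hW : IsGaussian b W r G' N') (hωW : IsQuasiFreeState b W (traceForm (r * r)))
    (x : Fin n → FockMatrix ι) (hΛ : IsQuasiFreeMap b V W (partitionMap x)) {k l : ℕ}
    (f : Fin k → H × H) (g : Fin l → H × H) :
    traceForm (krausColumns x s * (krausColumns x s)ᴴ)
        (wickMonomial (fun F => doubleCreation b G F.1 F.2)
          (fun F => (doubleCreation b G F.1 F.2)ᴴ) f g) =
      traceForm (pureDensity s ⊗ₖ (r * r))
        (wickMonomial (fun F : H × H => tripleCreation b G (V F.1) F.2 F.1)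
          (fun F => (tripleCreation b G (V F.1) F.2 F.1)ᴴ) f g) := by
  have hn : IsNormalWord ([] ++ ((List.ofFn fun i => (false, f i)) ++
      (List.ofFn fun j => (true, g j.rev))).map fun c => (c.1, c.2.1)) := by
    rw [List.nil_append, List.map_append, IsNormalWord, List.pairwise_append]
    refine ⟨?_, ?_, ?_⟩
    · rw [List.map_ofFn, List.pairwise_ofFn]
      intro i j _; exact le_rfl
    · rw [List.map_ofFn, List.pairwise_ofFn]
      intro i j _; exact le_rfl
    · intro c hc d hd
      rw [List.map_ofFn, List.mem_ofFn] at hc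
      obtain ⟨i, rfl⟩ := hc
      exact Bool.false_le _
  have key := h.dilation_double_word hW hωW x hΛ _ [] 1 hn
  simp only [List.map_nil, List.prod_nil, bimul_one_one, Matrix.one_kronecker_one, one_mul,
    List.map_append, List.prod_append, List.map_ofFn] at key
  exact key.symm

/-- The two-point function of the dilated state. -/
def doubleForm (Q V W : H →L[ℂ] H) (F' F : H × H) : ℂ :=
  inner ℂ (V F'.1) (Q (V F.1) + sqrtVar Q F.2) +
    inner ℂ F'.2 (sqrtVar Q (V F.1) + (1 - Q) F.2) + inner ℂ F'.1 (W F.1)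

theorem IsGaussian.krausColumns_wick_det [FiniteDimensional ℂ H] (h : IsGaussian b Q s G N)
    (hW : IsGaussian b W r G' N') (hQ : IsSymbol Q) (hWs : IsSymbol W)
    (x : Fin n → FockMatrix ι) (hΛ : IsQuasiFreeMap b V W (partitionMap x)) (k : ℕ)
    (f g : Fin k → H × H) :
    traceForm (krausColumns x s * (krausColumns x s)ᴴ)
        (wickMonomial (fun F => doubleCreation b G F.1 F.2)
          (fun F => (doubleCreation b G F.1 F.2)ᴴ) f g) =
      Matrix.det (Matrix.of fun i j => doubleForm Q V W (g i) (f j)) := by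
  rw [h.krausColumns_wickMonomial hW (hW.isQuasiFreeState hWs) x hΛ]
  -- The primed operator has the triple symbol applied to `(V f, k, f)`; pairing it with `(V f', k',
  -- f')` gives `doubleForm`.
  refine traceForm_wick_det (fun F : H × H => tripleCreation b G (V F.1) F.2 F.1)
    (fun F => tripleCreation b G (Q (V F.1) + sqrtVar Q F.2) (sqrtVar Q (V F.1) + (1 - Q) F.2)
      (W F.1)) (doubleForm Q V W) ?_ ?_ ?_ (h.trace_triple hW) k f g
  · intro F F'
    exact h.tripleCreation_anticomm (Q (V F.1) + sqrtVar Q F.2) (sqrtVar Q (V F.1) + (1 - Q) F.2)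
      (W F.1) (V F'.1) F'.2 F'.1
  · intro F' F
    exact h.tripleCreation_anticomm_conjTranspose (V F'.1) F'.2 F'.1
      (Q (V F.1) + sqrtVar Q F.2) (sqrtVar Q (V F.1) + (1 - Q) F.2) (W F.1)
  · intro F
    exact h.pureDensity_mul_tripleCreation hW hQ hWs (V F.1) F.2 F.1

theorem IsGaussian.krausColumns_wick_zero [FiniteDimensional ℂ H] (h : IsGaussian b Q s G N)
    (hW : IsGaussian b W r G' N') (hWs : IsSymbol W)
    (x : Fin n → FockMatrix ι) (hΛ : IsQuasiFreeMap b V W (partitionMap x)) {k l : ℕ} (hkl : k ≠ l)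
    (f : Fin k → H × H) (g : Fin l → H × H) :
    traceForm (krausColumns x s * (krausColumns x s)ᴴ)
        (wickMonomial (fun F => doubleCreation b G F.1 F.2)
          (fun F => (doubleCreation b G F.1 F.2)ᴴ) f g) = 0 := by
  rw [h.krausColumns_wickMonomial hW (hW.isQuasiFreeState hWs) x hΛ]
  exact traceForm_wick_zero (fun F : H × H => tripleCreation b G (V F.1) F.2 F.1)
    (h.conjTranspose_tripleNumber hW) (fun F => h.tripleNumber_mul hW (V F.1) F.2 F.1)
    (h.tripleNumber_mul_density hW) hkl f g

end Correlation

/-! ### The block symbol -/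

section BlockSymbol

variable {H : Type*} [NormedAddCommGroup H] [InnerProductSpace ℂ H] [CompleteSpace H]
  [FiniteDimensional ℂ H] {Q V W : H →L[ℂ] H}

theorem inner_blockSymbol (Q V W : H →L[ℂ] H) (x y : WithLp 2 (H × auxSpace Q)) :
    inner ℂ x (blockSymbol Q V W y) =
      doubleForm Q V W (x.fst, (x.snd : H)) (y.fst, (y.snd : H)) := by
  have h1 : (blockSymbol Q V W y).fst =
      star V (Q (V y.fst)) + W y.fst + star V (sqrtVar Q (y.snd : H)) := rfl
  have h2 : ((blockSymbol Q V W y).snd : H) =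
      sqrtVar Q (V y.fst) + (1 - Q) (y.snd : H) := rfl
  rw [WithLp.prod_inner_apply]
  change inner ℂ x.fst (blockSymbol Q V W y).fst +
    inner ℂ (x.snd : H) ((blockSymbol Q V W y).snd : H) = _
  rw [h1, h2, doubleForm, inner_add_right, inner_add_right, inner_add_right (V _),
    ContinuousLinearMap.star_eq_adjoint, ContinuousLinearMap.adjoint_inner_right,
    ContinuousLinearMap.adjoint_inner_right]
  ring

theorem doubleForm_self (hQ : IsSymbol Q) (F : H × H) :
    doubleForm Q V W F F =
      inner ℂ (CFC.sqrt Q (V F.1) + CFC.sqrt (1 - Q) F.2)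
        (CFC.sqrt Q (V F.1) + CFC.sqrt (1 - Q) F.2) + inner ℂ F.1 (W F.1) := by
  have hQ' : 0 ≤ 1 - Q := sub_nonneg.2 hQ.2
  rw [doubleForm]
  congr 1
  rw [inner_add_left, inner_sqrt_left, inner_sqrt_left, map_add, map_add,
    sqrt_apply_sqrt_apply hQ.1, sqrt_apply_sqrt_apply hQ', (hQ.sqrtVar_apply _).1,
    (hQ.sqrtVar_apply (V F.1)).2]

/-- For `x = (f, k)` both forms are a square plus a positive term: `⟨x, R x⟩ = ‖√Q V f + √(1-Q) k‖²
+ ⟨f, W f⟩` and `⟨x, (1-R) x⟩ = ‖√(1-Q) V f - √Q k‖² + ⟨f, (1 - V*V - W) f⟩`. -/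
theorem isSymbol_blockSymbol (hQ : IsSymbol Q) (hW0 : 0 ≤ W) (hW1 : W ≤ 1 - star V * V) :
    IsSymbol (blockSymbol Q V W) := by
  have hQ' : 0 ≤ 1 - Q := sub_nonneg.2 hQ.2
  have hpos : ∀ u : H, (0 : ℂ) ≤ inner ℂ u u := fun u => by
    rw [inner_self_eq_norm_sq_to_K]
    change (0 : ℂ) ≤ (‖u‖ : ℂ) ^ 2
    rw [← Complex.ofReal_pow]
    exact Complex.zero_le_real.2 (sq_nonneg _)
  have key : ∀ (E : Type _) [NormedAddCommGroup E] [InnerProductSpace ℂ E] (T : E →L[ℂ] E),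
      (∀ x, (0 : ℂ) ≤ inner ℂ x (T x)) → T.IsPositive := by
    intro E _ _ T hT
    rw [ContinuousLinearMap.isPositive_iff_complex]
    intro x
    have h1 : (0 : ℂ) ≤ inner ℂ (T x) x := by
      rw [← inner_conj_symm]
      have := star_nonneg_iff.2 (hT x)
      exact this
    obtain ⟨h2, h3⟩ := Complex.nonneg_iff.1 h1
    refine ⟨?_, h2⟩
    exact (Complex.ext (by simp) (by simpa using h3))
  constructor
  · rw [ContinuousLinearMap.nonneg_iff_isPositive]
    refine key _ _ fun x => ?_
    rw [inner_blockSymbol, doubleForm_self hQ]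
    exact add_nonneg (hpos _)
      (((ContinuousLinearMap.nonneg_iff_isPositive _).1 hW0).inner_nonneg_right _)
  · rw [ContinuousLinearMap.le_def]
    refine key _ _ fun x => ?_
    have hx := ((ContinuousLinearMap.le_def _ _).1 hW1).inner_nonneg_right x.fst
    have h0 : inner ℂ x.fst ((1 - star V * V - W) x.fst) =
        inner ℂ x.fst x.fst - inner ℂ (V x.fst) (V x.fst) - inner ℂ x.fst (W x.fst) := by
      rw [_root_.sub_apply, _root_.sub_apply, inner_sub_right, inner_sub_right,
        one_apply_eq_self, mul_apply_eq_comp, ContinuousLinearMap.star_eq_adjoint,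
        ContinuousLinearMap.adjoint_inner_right]
    have h1 : inner ℂ x ((1 - blockSymbol Q V W) x) =
        inner ℂ (CFC.sqrt (1 - Q) (V x.fst) - CFC.sqrt Q (x.snd : H))
          (CFC.sqrt (1 - Q) (V x.fst) - CFC.sqrt Q (x.snd : H)) +
        inner ℂ x.fst ((1 - star V * V - W) x.fst) := by
      rw [h0, _root_.sub_apply, inner_sub_right, one_apply_eq_self, inner_blockSymbol,
        WithLp.prod_inner_apply, doubleForm, inner_sub_left, inner_sqrt_left, inner_sqrt_left,
        map_sub, map_sub, sqrt_apply_sqrt_apply hQ.1, sqrt_apply_sqrt_apply hQ',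
        ← (hQ.sqrtVar_apply _).1, ← (hQ.sqrtVar_apply _).2]
      change inner ℂ x.fst x.fst + inner ℂ (x.snd : H) (x.snd : H) - _ = _
      simp only [inner_add_right, inner_sub_right, _root_.sub_apply, one_apply_eq_self]
      ring
    rw [h1]
    exact add_nonneg (hpos _) hx

end BlockSymbol

/-! ### The modes outside `K` and the eigenvalue sum -/

section Modes

variable {H : Type*} [NormedAddCommGroup H] [InnerProductSpace ℂ H] [CompleteSpace H]
  [FiniteDimensional ℂ H] {Q : H →L[ℂ] H}

/-- An eigenbasis of `1 - Q` on the kernel of `Q (1 - Q)`. -/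
theorem IsSymbol.exists_kernel_basis (hQ : IsSymbol Q) :
    ∃ (n : ℕ) (e : Fin n → H) (l : Fin n → ℝ),
      n + Module.finrank ℂ (auxSpace Q) = Module.finrank ℂ H ∧
      (∀ i j, inner ℂ (e i) (e j) = if i = j then (1 : ℂ) else 0) ∧
      (∀ i, (1 - Q) (e i) = (l i : ℂ) • e i) ∧ (∀ i, l i = 0 ∨ l i = 1) ∧
      (∀ i, ∀ k ∈ auxSpace Q, inner ℂ (e i) k = (0 : ℂ)) ∧ ∀ i, sqrtVar Q (e i) = 0 := by
  have hQ' : 0 ≤ 1 - Q := sub_nonneg.2 hQ.2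
  have hT : 0 ≤ Q * (1 - Q) := (Commute.one_right Q).sub_right (Commute.refl Q) |>.mul_nonneg
    hQ.1 hQ'
  have hTs : (Q * (1 - Q)).toLinearMap.IsSymmetric :=
    ((ContinuousLinearMap.nonneg_iff_isPositive _).1 hT).isSymmetric
  have hS : (1 - Q).toLinearMap.IsSymmetric :=
    ((ContinuousLinearMap.nonneg_iff_isPositive _).1 hQ').isSymmetric
  let K0 : Submodule ℂ H := LinearMap.ker (Q * (1 - Q)).toLinearMap
  have hK0 : ∀ u : K0, (Q * (1 - Q)) (u : H) = 0 := fun u => u.2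
  have hinv : ∀ u ∈ K0, (1 - Q).toLinearMap u ∈ K0 := by
    intro u hu
    have hu' : (Q * (1 - Q)) u = 0 := hu
    have hc : (Q * (1 - Q)) ((1 - Q) u) = (1 - Q) ((Q * (1 - Q)) u) := by simp
    change (Q * (1 - Q)) ((1 - Q) u) = 0
    rw [hc, hu', map_zero]
  have hSr := hS.restrict_invariant hinv
  let e := hSr.eigenvectorBasis rfl
  let l := hSr.eigenvalues rfl
  have he : ∀ i, (1 - Q) (e i : H) = (l i : ℂ) • (e i : H) := fun i =>
    congrArg Subtype.val (hSr.apply_eigenvectorBasis rfl i)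
  refine ⟨Module.finrank ℂ K0, fun i => (e i : H), l, ?_, fun i j => ?_, he, fun i => ?_,
    fun i k hk => ?_, fun i => ?_⟩
  · rw [add_comm]
    exact LinearMap.finrank_range_add_finrank_ker _
  · exact orthonormal_iff_ite.1 e.orthonormal i j
  -- On the kernel of `Q (1 - Q)` an eigenvalue satisfies `l (1 - l) = 0`.
  · have hQe : Q (e i : H) = (1 - l i : ℂ) • (e i : H) := by
      have := he i
      rw [_root_.sub_apply, one_apply_eq_self] at this
      rw [sub_smul, one_smul, ← this]; abel
    have h1 := hK0 (e i)
    rw [mul_apply_eq_comp, he, map_smul, hQe, smul_smul] at h1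
    have h2 : (e i : H) ≠ 0 := by
      have := e.orthonormal.ne_zero i
      simpa using this
    rcases mul_eq_zero.1 ((smul_eq_zero.1 h1).resolve_right h2) with h3 | h3
    · left; exact_mod_cast h3
    · right
      have : (l i : ℂ) = 1 := (sub_eq_zero.1 h3).symm
      exact_mod_cast this
  · obtain ⟨y, rfl⟩ := hk
    rw [← hTs]
    change inner ℂ ((Q * (1 - Q)) (e i : H)) y = 0
    rw [hK0, inner_zero_left]
  · have := sqrt_apply_of_eigen hT le_rfl (e := (e i : H)) (by simpa using hK0 (e i))
    simpa [sqrtVar] using this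

/-- The doubled Fock space carries modes over `H ⊕ H`, while `R` lives on `H ⊕ K`. An eigenbasis of
`R` is therefore completed by vectors `(0, k i)` with `k i` in the kernel of `Q (1 - Q)`;
`doubleForm` stays diagonal, and the new eigenvalues are 0 or 1. -/
theorem partitionEntropy_eq_sum {ι : Type*} [Fintype ι] [LinearOrder ι]
    (b : OrthonormalBasis ι ℂ H) {V W : H →L[ℂ] H} {ω : FockMatrix ι →ₗ[ℂ] ℂ}
    (hω : IsQuasiFreeState b Q ω) {n : ℕ} (x : Fin n → FockMatrix ι)
    (hΛ : IsQuasiFreeMap b V W (partitionMap x)) {p : ℕ}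
    (e : OrthonormalBasis (Fin p) ℂ (WithLp 2 (H × auxSpace Q))) (l : Fin p → ℝ)
    (he : ∀ i, blockSymbol Q V W (e i) = (l i : ℂ) • e i) (hl : ∀ i, 0 ≤ l i ∧ l i ≤ 1) :
    partitionEntropy ω x = ∑ i, (Real.negMulLog (l i) + Real.negMulLog (1 - l i)) := by
  have hQ := hω.isSymbol
  obtain ⟨-, -, ωW, hωW, -⟩ := id hΛ
  have hW := hωW.isSymbol
  obtain ⟨eQ, lQ, heQ⟩ := hQ.exists_eigenbasis
  obtain ⟨s, G, N, hs, -⟩ := hQ.exists_isGaussian b eQ lQ heQ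
  obtain ⟨eW, lW, heW⟩ := hW.exists_eigenbasis
  obtain ⟨r, G', N', hr, -⟩ := hW.exists_isGaussian b eW lW heW
  obtain rfl := hω.unique (hs.isQuasiFreeState hQ)
  rw [partitionEntropy_traceForm hs.conjTranspose_eq]
  obtain ⟨q, k, lk, hcard, hk, hke, hk01, hkorth, hksq⟩ := hQ.exists_kernel_basis
  -- The lexicographic sum supplies the linear order that the Jordan-Wigner signs need.
  let J := Fin p ⊕ₗ Fin q
  let F : J → H × H := fun j =>
    Sum.elim (fun i => ((e i).fst, ((e i).snd : H))) (fun i => (0, k i)) (ofLex j)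
  let lJ : J → ℝ := fun j => Sum.elim l lk (ofLex j)
  have hlJ : ∀ j, 0 ≤ lJ j ∧ lJ j ≤ 1 := by
    intro j
    obtain ⟨j, rfl⟩ := toLex.surjective j
    rcases j with i | i
    · exact hl i
    · change 0 ≤ lk i ∧ lk i ≤ 1
      rcases hk01 i with h | h <;> simp [h]
  have hkorth' : ∀ i, ∀ u ∈ auxSpace Q, inner ℂ u (k i) = (0 : ℂ) := fun i u hu => by
    rw [← inner_conj_symm, hkorth i u hu, map_zero]
  have horth : ∀ i j, inner ℂ (F i).1 (F j).1 + inner ℂ (F i).2 (F j).2 =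
      if i = j then (1 : ℂ) else 0 := by
    intro i j
    obtain ⟨i, rfl⟩ := toLex.surjective i
    obtain ⟨j, rfl⟩ := toLex.surjective j
    refine Eq.trans ?_ (if_congr (toLex_inj (a := i) (b := j)) rfl rfl).symm
    rcases i with i | i <;> rcases j with j | j
    · have := orthonormal_iff_ite.1 e.orthonormal i j
      rw [WithLp.prod_inner_apply] at this
      simp only [Sum.inl.injEq]
      exact this
    · simp only [reduceCtorEq, if_false]
      change inner ℂ (e i).fst (0 : H) + inner ℂ ((e i).snd : H) (k j) = 0
      rw [inner_zero_right, zero_add, hkorth' j _ (e i).snd.2]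
    · simp only [reduceCtorEq, if_false]
      change inner ℂ (0 : H) (e j).fst + inner ℂ (k i) ((e j).snd : H) = 0
      rw [inner_zero_left, zero_add, hkorth i _ (e j).snd.2]
    · simp only [Sum.inr.injEq]
      change inner ℂ (0 : H) (0 : H) + inner ℂ (k i) (k j) = _
      rw [inner_zero_left, zero_add, hk]
  have hform : ∀ i j, doubleForm Q V W (F i) (F j) = if i = j then (lJ j : ℂ) else 0 := by
    intro i j
    obtain ⟨i, rfl⟩ := toLex.surjective i
    obtain ⟨j, rfl⟩ := toLex.surjective j
    refine Eq.trans ?_ (if_congr (toLex_inj (a := i) (b := j)) rfl rfl).symm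
    rcases i with i | i <;> rcases j with j | j
    · have := inner_blockSymbol Q V W (e i) (e j)
      rw [he, inner_smul_right, orthonormal_iff_ite.1 e.orthonormal i j] at this
      simp only [Sum.inl.injEq]
      refine Eq.trans this.symm ?_
      change (l j : ℂ) * _ = if i = j then (l j : ℂ) else 0
      split_ifs <;> simp
    · simp only [reduceCtorEq, if_false]
      change doubleForm Q V W ((e i).fst, ((e i).snd : H)) (0, k j) = 0
      simp [doubleForm, hksq, -_root_.sub_apply, hke,
        hkorth' j _ (e i).snd.2]
    · simp only [reduceCtorEq, if_false]
      change doubleForm Q V W (0, k i) ((e j).fst, ((e j).snd : H)) = 0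
      simp only [doubleForm, map_zero, inner_zero_left, zero_add, add_zero, inner_add_right]
      rw [hkorth i _ (sqrtVar_mem Q _), hkorth i _ (one_sub_mem Q (e j).snd.2), add_zero]
    · simp only [Sum.inr.injEq]
      change doubleForm Q V W (0, k i) (0, k j) = if i = j then (lk j : ℂ) else 0
      simp only [doubleForm, map_zero, inner_zero_left, zero_add, add_zero, hke,
        inner_smul_right, hk]
      split_ifs <;> simp
  have hCAR : IsCAR fun j => doubleCreation b G (F j).1 (F j).2 := by
    refine ⟨fun i j => hs.doubleCreation_anticomm _ _ _ _, fun i j => ?_⟩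
    rw [hs.doubleCreation_anticomm_conjTranspose, horth]
    split_ifs <;> simp
  have hp : p = Module.finrank ℂ H + Module.finrank ℂ (auxSpace Q) := by
    have h1 := Module.finrank_eq_card_basis e.toBasis
    rw [Fintype.card_fin] at h1
    rw [← h1, LinearEquiv.finrank_eq (WithLp.linearEquiv 2 ℂ (H × auxSpace Q)),
      Module.finrank_prod]
  have hd : Fintype.card ι = Module.finrank ℂ H := (Module.finrank_eq_card_basis b.toBasis).symm
  have hJ : Fintype.card J = p + q := by
    rw [show Fintype.card J = Fintype.card (Fin p ⊕ Fin q) from Fintype.card_congr ofLex]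
    simp
  -- Minimality of the representation: `p + q` is twice the dimension of `H`.
  have hcardJ : Fintype.card (Finset ι × Finset ι) = 2 ^ Fintype.card J := by
    rw [Fintype.card_prod, Fintype.card_finset, ← pow_add, hJ]
    congr 1
    omega
  rw [hCAR.vonNeumannEntropy_eq hcardJ (fun j => (hlJ j).1) (fun j => (hlJ j).2)]
  · rw [← Equiv.sum_comp (toLex : Fin p ⊕ Fin q ≃ J), Fintype.sum_sum_type]
    change ∑ i, (Real.negMulLog (l i) + Real.negMulLog (1 - l i)) +
      ∑ i, (Real.negMulLog (lk i) + Real.negMulLog (1 - lk i)) = _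
    rw [Finset.sum_eq_zero (s := Finset.univ (α := Fin q)), add_zero]
    intro i _
    rcases hk01 i with h | h <;> simp [h]
  · intro d f g
    refine (hs.krausColumns_wick_det hr hQ hW x hΛ d (fun i => F (f i)) fun i => F (g i)).trans ?_
    simp only [hform]
    congr!
  · intro d d' f g hdd
    exact hs.krausColumns_wick_zero hr hW x hΛ hdd (fun i => F (f i)) fun i => F (g i)

end Modes

end

end FermionEntropy

/-! ### Both entropies as the same sum over the eigenvalues of `R` -/

theorem mainTheorem4
    {H : Type*} [NormedAddCommGroup H] [InnerProductSpace ℂ H] [CompleteSpace H]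
    [FiniteDimensional ℂ H]
    {ι : Type*} [Fintype ι] [LinearOrder ι] (b : OrthonormalBasis ι ℂ H)
    (Q V W : H →L[ℂ] H)
    {κ : Type*} [Fintype κ] [LinearOrder κ]
    (c : OrthonormalBasis κ ℂ (WithLp 2 (H × FermionEntropy.auxSpace Q)))
    (ω : FermionEntropy.FockMatrix ι →ₗ[ℂ] ℂ)
    (hω : FermionEntropy.IsQuasiFreeState b Q ω)
    (n : ℕ) (x : Fin n → FermionEntropy.FockMatrix ι)
    (hx : FermionEntropy.IsOperationalPartition x)
    (hΛ : FermionEntropy.IsQuasiFreeMap b V W (FermionEntropy.partitionMap x)) :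
    FermionEntropy.IsSymbol (FermionEntropy.blockSymbol Q V W) ∧
    ∃ ωR : FermionEntropy.FockMatrix κ →ₗ[ℂ] ℂ,
      FermionEntropy.IsQuasiFreeState c (FermionEntropy.blockSymbol Q V W) ωR ∧
      (∀ ω' : FermionEntropy.FockMatrix κ →ₗ[ℂ] ℂ,
        FermionEntropy.IsQuasiFreeState c (FermionEntropy.blockSymbol Q V W) ω' → ω' = ωR) ∧
      FermionEntropy.partitionEntropy ω x = FermionEntropy.stateEntropy ωR := by
  have hR := FermionEntropy.isSymbol_blockSymbol hω.isSymbol hΛ.1 hΛ.2.1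
  obtain ⟨e, l, he⟩ := hR.exists_eigenbasis
  obtain ⟨s, G, N, hs, hS⟩ := hR.exists_isGaussian c e l he
  have hq := hs.isQuasiFreeState hR
  refine ⟨hR, _, hq, fun ω' hω' => hω'.unique hq, ?_⟩
  rw [FermionEntropy.partitionEntropy_eq_sum b hω x hΛ e l he
    fun i => hR.eigenvalue_mem (e.orthonormal.1 i) (he i), FermionEntropy.stateEntropy,
    FermionEntropy.densityMatrix_traceForm, hS]
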